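/- Let $\tilde L\subset\mathbb R^m\times\mathbb R^n$ be a lattice (a discrete subgroup spanning $\mathbb R^m\times\mathbb R^n$) such that the projection $\pi_1$ to $\mathbb R^m$ is injective on $\tilde L$ and the projection $\pi_2(\tilde L)$ is dense in $\mathbb R^n$. Let $L=\pi_1(\tilde L)$ and let $(\,)^*=\pi_2\circ(\pi_1|_{\tilde L})^{-1}:L\to\mathbb R^n$. Let $\Omega\subset\mathbb R^n$ be non-empty and compact, with $\Omega=\overline{\mathrm{int}(\Omega)}$ and with boundary of Lebesgue measure $0$, and let $\Lambda=\{x\in L\mid x^*\in\Omega\}$ be the corresponding model set. Let $Q$ be a linear similarity of $\mathbb R^m$ (a non-zero multiple of an orthogonal transformation) with $QL=L$, and let $A=Q^*$ be the linear map of $\mathbb R^n$ that is induced by $Q$, i.e. $(Qx)^*=Ax^*$ for all $x\in L$. Put $\Omega_Q=\{u\in\mathbb R^n\mid A\Omega+u\subset\Omega\}$ and assume that $Q$ is compatible with $\Lambda$, i.e. $\mathrm{int}(\Omega_Q)\neq\emptyset$, and that the boundary of $\Omega_Q$ has Lebesgue measure $0$. Let $T$ be the set of all $v\in\mathbb R^m$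 for which $t_v:x\mapsto Qx+v$ maps $\Lambda$ into itself, and for a set $S\subset\mathbb R^m$ let $S_s=\{x\in S\mid |x|\le s\}$. A $Q$-invariant density on $\Lambda$ is a function $p:L\to\mathbb R$ that vanishes off $\Lambda$, is non-negative, is a fixed point of the averaging operator, i.e. $$\lim_{s\to\infty}\frac{|\det Q|}{\#T_s}\sum_{v\in T_s}p(t_v^{-1}x)=p(x)\qquad\text{for all }x\in L,$$ and is normalized, i.e. $\lim_{s\to\infty}\frac1{\#\Lambda_s}\sum_{x\in\Lambda_s}p(x)=1$. Let $\mathcal C(\Omega)$ be the space of continuous complex-valued functions on $\mathbb R^n$ with support in $\Omega$. For a function $f$ on $\mathbb R^n$ let $p_f(x)=\mathrm{vol}(\Omega)\,f(x^*)$ for $x\in\Lambda$ and $p_f(x)=0$ for $x\in L\setminus\Lambda$, and let $\mathcal C(\Lambda)=\{p_f\mid f\in\mathcal C(\Omega)\}$. For a measurable set $S\subset\mathbb R^n$ with $0<\mathrm{vol}(S)<\infty$ let $X_S=\mathbf 1_S/\mathrm{vol}(S)$, and let $\hat f(k)=\int_{\mathbb R^n}e^{-2\pi i k\cdot x}f(x)\,dx$.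 Then there is a unique $Q$-invariant density $p$ on $\Lambda$ lying in $\mathcal C(\Lambda)$. It is $p=p_f$, where $f:\mathbb R^n\to\mathbb R$ is the infinite convolution $$f=\mathop{\ast}_{N=0}^{\infty}X_{A^N\Omega_Q},$$ i.e. the uniform limit, as $N\to\infty$, of $X_{\Omega_Q}*X_{A\Omega_Q}*\cdots*X_{A^N\Omega_Q}$. The function $f$ is non-negative, of class $C^\infty$, supported in $\Omega$, and $\int_{\mathbb R^n}f=1$. Equivalently, $f$ is the unique function in $\mathcal C(\Omega)$ whose Fourier transform is $$\hat f(k)=\prod_{N=0}^{\infty}\hat X_{\Omega_Q}\big((A^t)^Nk\big)\qquad\text{for all }k\in\mathbb R^n,$$ where the infinite product converges unconditionally. -/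

import Mathlib

open Set Filter Topology MeasureTheory
open scoped FourierTransform Convolution ContDiff

noncomputable section

/-- A cut and project scheme `ℝ^m ← ℝ^m × ℝ^n → ℝ^n` with a lattice (a discrete subgroup spanning
`ℝ^m × ℝ^n`) on which the first projection is injective and whose second projection is dense. -/
structure CutProjectScheme (m n : ℕ) where
  lattice : Submodule ℤ (EuclideanSpace ℝ (Fin m) × EuclideanSpace ℝ (Fin n))
  discrete : DiscreteTopology lattice
  isZLattice : IsZLattice ℝ lattice
  injOn_fst : InjOn Prod.fst
    (lattice : Set (EuclideanSpace ℝ (Fin m) × EuclideanSpace ℝ (Fin n)))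
  dense_snd : Dense (Prod.snd ''
    (lattice : Set (EuclideanSpace ℝ (Fin m) × EuclideanSpace ℝ (Fin n))))

/-- A (linear) similarity: a nonzero multiple of an orthogonal transformation. -/
def IsLinearSimilarity {m : ℕ}
    (Q : EuclideanSpace ℝ (Fin m) ≃ₗ[ℝ] EuclideanSpace ℝ (Fin m)) : Prop :=
  ∃ q : ℝ, q ≠ 0 ∧ ∃ R : EuclideanSpace ℝ (Fin m) ≃ₗᵢ[ℝ] EuclideanSpace ℝ (Fin m),
    ∀ x, Q x = q • R x

/-- The window conditions: `Ω` is compact, is the closure of its interior, and has a boundary of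
Lebesgue measure zero. -/
structure IsWindow {n : ℕ} (Ω : Set (EuclideanSpace ℝ (Fin n))) : Prop where
  isCompact : IsCompact Ω
  eq_closure_interior : Ω = closure (interior Ω)
  volume_frontier : volume (frontier Ω) = 0

/-- `T_s`, the points of `T` of Euclidean length at most `s`. -/
def truncate {m : ℕ} (T : Set (EuclideanSpace ℝ (Fin m))) (s : ℝ) :
    Set (EuclideanSpace ℝ (Fin m)) :=
  {x ∈ T | ‖x‖ ≤ s}

/-- `Ω_Q = {u | A Ω + u ⊆ Ω}`. -/
def transWindow {n : ℕ} (A : EuclideanSpace ℝ (Fin n) →ₗ[ℝ] EuclideanSpace ℝ (Fin n))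
    (Ω : Set (EuclideanSpace ℝ (Fin n))) : Set (EuclideanSpace ℝ (Fin n)) :=
  {u | ∀ y ∈ Ω, A y + u ∈ Ω}

/-- The normalized indicator function `X_S = 1_S / vol(S)`. -/
def normIndicator {n : ℕ} (S : Set (EuclideanSpace ℝ (Fin n))) :
    EuclideanSpace ℝ (Fin n) → ℝ :=
  S.indicator fun _ => (volume.real S)⁻¹

/-- The partial convolution product `X_0 ⋆ X_1 ⋆ ⋯ ⋆ X_N` of a sequence of functions. -/
def partialConvolution {n : ℕ} (X : ℕ → EuclideanSpace ℝ (Fin n) → ℝ) :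
    ℕ → EuclideanSpace ℝ (Fin n) → ℝ
  | 0 => X 0
  | N + 1 => partialConvolution X N ⋆[ContinuousLinearMap.mul ℝ ℝ, volume] X (N + 1)

/-- `𝒞(Ω)`: the continuous complex-valued functions on `ℝ^n` with support in `Ω`. -/
def windowFunctions {n : ℕ} (Ω : Set (EuclideanSpace ℝ (Fin n))) :
    Set (EuclideanSpace ℝ (Fin n) → ℂ) :=
  {f | Continuous f ∧ tsupport f ⊆ Ω}

namespace CutProjectScheme

variable {m n : ℕ} (S : CutProjectScheme m n)

/-- `L`, the projection of the lattice to physical space. -/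
def L : Set (EuclideanSpace ℝ (Fin m)) :=
  Prod.fst '' (S.lattice : Set (EuclideanSpace ℝ (Fin m) × EuclideanSpace ℝ (Fin n)))

/-- The star map `π₂ ∘ (π₁|lattice)⁻¹` on `L` (its values off `L` are irrelevant). -/
def star (x : EuclideanSpace ℝ (Fin m)) : EuclideanSpace ℝ (Fin n) :=
  (Function.invFunOn Prod.fst
    (S.lattice : Set (EuclideanSpace ℝ (Fin m) × EuclideanSpace ℝ (Fin n))) x).2

/-- The cut and project set `Λ(Ω) = {x ∈ L | x* ∈ Ω}`. -/
def modelSet (Ω : Set (EuclideanSpace ℝ (Fin n))) : Set (EuclideanSpace ℝ (Fin m)) :=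
  {x ∈ S.L | S.star x ∈ Ω}

/-- `A = Q*`: the linear map `A` of internal space satisfies `(Q x)* = A x*` on `L`. There is at
most one such `A`, because `L*` is dense in `ℝ^n`. -/
def IsStarMap (Q : EuclideanSpace ℝ (Fin m) ≃ₗ[ℝ] EuclideanSpace ℝ (Fin m))
    (A : EuclideanSpace ℝ (Fin n) →ₗ[ℝ] EuclideanSpace ℝ (Fin n)) : Prop :=
  ∀ x ∈ S.L, S.star (Q x) = A (S.star x)

/-- `T_Q`: the `v` for which `x ↦ Q x + v` is a self-similarity of `Λ(Ω)`, i.e. maps `Λ(Ω)` into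
itself. -/
def translations (Ω : Set (EuclideanSpace ℝ (Fin n)))
    (Q : EuclideanSpace ℝ (Fin m) ≃ₗ[ℝ] EuclideanSpace ℝ (Fin m)) :
    Set (EuclideanSpace ℝ (Fin m)) :=
  {v | MapsTo (fun x => Q x + v) (S.modelSet Ω) (S.modelSet Ω)}

/-- The average of `p` over the self-similarities with translation part of length at most `s`:
`|det Q| / #T_s * ∑_{v ∈ T_s} p (t_v⁻¹ x)`, where `t_v⁻¹ x = Q⁻¹ (x - v)`. -/
def partialAverage (Ω : Set (EuclideanSpace ℝ (Fin n)))
    (Q : EuclideanSpace ℝ (Fin m) ≃ₗ[ℝ] EuclideanSpace ℝ (Fin m))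
    (p : EuclideanSpace ℝ (Fin m) → ℝ) (s : ℝ) (x : EuclideanSpace ℝ (Fin m)) : ℝ :=
  |LinearMap.det (Q : EuclideanSpace ℝ (Fin m) →ₗ[ℝ] EuclideanSpace ℝ (Fin m))| /
      ((truncate (S.translations Ω Q) s).ncard : ℝ) *
    ∑ᶠ v ∈ truncate (S.translations Ω Q) s, p (Q.symm (x - v))

/-- `Q`-invariant densities on `Λ(Ω)`. A function on `L` that vanishes off `Λ(Ω)` is represented by
its extension by zero to `ℝ^m`. The averaging operator is the limit of the partial averages as
`s → ∞`; its existence is part of the fixed point condition. -/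
structure IsInvariantDensity (Ω : Set (EuclideanSpace ℝ (Fin n)))
    (Q : EuclideanSpace ℝ (Fin m) ≃ₗ[ℝ] EuclideanSpace ℝ (Fin m))
    (p : EuclideanSpace ℝ (Fin m) → ℝ) : Prop where
  eq_zero : ∀ x, x ∉ S.modelSet Ω → p x = 0
  nonneg : ∀ x ∈ S.modelSet Ω, 0 ≤ p x
  average_eq : ∀ x ∈ S.L, Tendsto (fun s : ℝ => S.partialAverage Ω Q p s x) atTop (𝓝 (p x))
  normalized : Tendsto
    (fun s : ℝ => (∑ᶠ x ∈ truncate (S.modelSet Ω) s, p x) /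
      ((truncate (S.modelSet Ω) s).ncard : ℝ)) atTop (𝓝 1)

/-- `p_f`: the function `x ↦ vol(Ω) f(x*)` on `Λ(Ω)`, and `0` elsewhere. -/
def pullback {V : Type*} [AddCommGroup V] [Module ℝ V] (Ω : Set (EuclideanSpace ℝ (Fin n)))
    (f : EuclideanSpace ℝ (Fin n) → V) : EuclideanSpace ℝ (Fin m) → V :=
  (S.modelSet Ω).indicator fun x => volume.real Ω • f (S.star x)

/-- `𝒞(Λ)`: the functions `p_f` with `f ∈ 𝒞(Ω)`. -/
def modelFunctions (Ω : Set (EuclideanSpace ℝ (Fin n))) :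
    Set (EuclideanSpace ℝ (Fin m) → ℂ) :=
  S.pullback Ω '' windowFunctions Ω

end CutProjectScheme

end

/-! The proof turns invariance of `p_g` into a functional equation for `g`. The translation set `T`
is itself a model set, with window `Ω_Q` (`translations_eq`), and model sets are uniformly
distributed in their windows (`tendsto_latticeSum_div_ncard`). Averaging `p_g` over `T_s` therefore
tends to `p_{Rg}`, where `R` is `refinementOperator`: rescale `g` by `A` and convolve with `X_{Ω_Q}`
(`tendsto_partialAverage`). The factor `|det Q|` is the right one because `Q × A` preserves the
lattice, whence `|det Q| |det A| = 1`. As `L*` is dense, invariance of `p_g` for continuous `g`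
amounts to `Rg = g`, and normalization to `∫ g = 1`.

On the Fourier side `Rg = g` reads `ĝ(k) = X̂(k) ĝ(Aᵗ k)`, with `X = X_{Ω_Q}`. Iterating, and using
`(Aᵗ)^N k → 0` and `ĝ(0) = 1`, forces `ĝ` to be the infinite product; this gives uniqueness.

All convergence rests on `summable_norm_adjoint_pow`: a ball inside `Ω_Q` allows independent
perturbations at every stage of a composition of maps `y ↦ A y + u`, all of which preserve the
bounded set `Ω`, so `∑ ‖(Aᵗ)^j w‖` is bounded. Hence the sets `A^N Ω_Q` shrink summably to the
origin. The partial convolutions then converge uniformly, because convolving with a density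
supported in a small ball moves a function by no more than its oscillation at that scale, and the
Fourier product converges absolutely. Smoothness follows from the equation again: `X̂` vanishes at
infinity while `Aᵗ` shrinks a vector by at most a fixed factor, so `f̂` decays faster than every
power (`rapid_decay_of_refinement`).

Uniform distribution is proved without computing the density of the lattice. Lattice sums are
asymptotically invariant under internal translations, since these are approximated by lattice
translations, which only affect a thin shell. As in the uniqueness proof for Haar measure,
evaluating the lattice sum of `g ⋆ h = h ⋆ g` in two ways shows that the sums are asymptotically
proportional to integrals. -/

/-! ### Infinite convolutions of shrinking densities -/

/-- A sequence of probability densities whose supports shrink summably fast to the origin, such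
that the density of index one is bounded. -/
structure IsShrinkingDensitySeq {n : ℕ} (X : ℕ → EuclideanSpace ℝ (Fin n) → ℝ) (r : ℕ → ℝ) :
    Prop where
  nonneg : ∀ j x, 0 ≤ X j x
  integral_eq_one : ∀ j, ∫ x, X j x = 1
  support_subset : ∀ j, Function.support (X j) ⊆ Metric.ball 0 (r j)
  radius_nonneg : ∀ j, 0 ≤ r j
  summable : Summable r
  bounded : ∃ C, ∀ x, |X 1 x| ≤ C

/-- The convolution of an integrable function and a bounded integrable function is continuous. -/
theorem continuous_convolution_of_bounded {n : ℕ} {f g : EuclideanSpace ℝ (Fin n) → ℝ}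
    (hf : Integrable f) (hg : Integrable g) {C : ℝ} (hC : ∀ x, |g x| ≤ C) :
    Continuous (f ⋆[ContinuousLinearMap.mul ℝ ℝ, volume] g) := by
  have hC0 : 0 ≤ C := (abs_nonneg _).trans (hC 0)
  have hint : ∀ (φ : EuclideanSpace ℝ (Fin n) → ℝ), Integrable φ → ∀ x,
      Integrable fun t => φ t * g (x - t) := fun φ hφ x =>
    hφ.mul_bdd (c := C) ((hg.comp_sub_left x).aestronglyMeasurable)
      (Eventually.of_forall fun t => hC _)
  refine continuous_of_uniform_approx_of_continuous fun U hU => ?_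
  obtain ⟨ε, hε, hεU⟩ := Metric.mem_uniformity_dist.1 hU
  -- An `L¹` approximation of `f` gives a uniform approximation of the convolution, since `g` is
  -- bounded by `C`.
  obtain ⟨φ, hφc, hφ, hφcont, hφi⟩ :=
    hf.exists_hasCompactSupport_integral_sub_le (ε := ε / (2 * (C + 1))) (by positivity)
  refine ⟨φ ⋆[ContinuousLinearMap.mul ℝ ℝ, volume] g,
    hφc.continuous_convolution_left _ hφcont hg.locallyIntegrable, fun x => hεU ?_⟩
  rw [convolution_mul, convolution_mul, dist_eq_norm, ← integral_sub (hint f hf x) (hint φ hφi x)]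
  calc ‖∫ t, (f t * g (x - t) - φ t * g (x - t))‖
      ≤ ∫ t, ‖f t - φ t‖ * C := by
        refine norm_integral_le_of_norm_le ((hf.sub hφi).norm.mul_const C)
          (Eventually.of_forall fun t => ?_)
        rw [← sub_mul, norm_mul]
        exact mul_le_mul_of_nonneg_left (hC _) (norm_nonneg _)
    _ = (∫ t, ‖f t - φ t‖) * C := integral_mul_const _ _
    _ ≤ ε / (2 * (C + 1)) * C := by gcongr
    _ < ε := by
        rw [div_mul_eq_mul_div, div_lt_iff₀ (by positivity)]
        nlinarith

namespace IsShrinkingDensitySeq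

variable {n : ℕ} {X : ℕ → EuclideanSpace ℝ (Fin n) → ℝ} {r : ℕ → ℝ}

theorem integrable (h : IsShrinkingDensitySeq X r) (j : ℕ) : Integrable (X j) :=
  integrable_of_integral_eq_one (h.integral_eq_one j)

/-- With the new factor on the left, a convolution step is an average of translates of the previous
function against a probability density. -/
theorem partialConvolution_succ_eq (N : ℕ) :
    partialConvolution X (N + 1) =
      X (N + 1) ⋆[ContinuousLinearMap.lsmul ℝ ℝ, volume] partialConvolution X N := by
  ext x
  rw [convolution_lsmul, partialConvolution, convolution_mul_swap]
  simp only [smul_eq_mul, mul_comm]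

theorem partialConvolution_integrable (h : IsShrinkingDensitySeq X r) (N : ℕ) :
    Integrable (partialConvolution X N) := by
  induction N with
  | zero => exact h.integrable 0
  | succ N ih => exact ih.integrable_convolution _ (h.integrable _)

theorem partialConvolution_nonneg (h : IsShrinkingDensitySeq X r) (N : ℕ)
    (x : EuclideanSpace ℝ (Fin n)) : 0 ≤ partialConvolution X N x := by
  induction N generalizing x with
  | zero => exact h.nonneg 0 x
  | succ N ih =>
    rw [partialConvolution, convolution_mul]
    exact integral_nonneg fun t => mul_nonneg (ih _) (h.nonneg _ _)

/-- Radii add under convolution; their total gives one compact set for all `N`, as dominated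
convergence will require. -/
theorem partialConvolution_support (h : IsShrinkingDensitySeq X r) (N : ℕ) :
    Function.support (partialConvolution X N) ⊆ Metric.closedBall 0 (∑' j, r j) := by
  suffices Function.support (partialConvolution X N) ⊆
      Metric.closedBall 0 (∑ j ∈ Finset.range (N + 1), r j) from
    this.trans (Metric.closedBall_subset_closedBall
      (h.summable.sum_le_tsum _ fun j _ => h.radius_nonneg j))
  induction N with
  | zero => simpa [partialConvolution] using
      (h.support_subset 0).trans Metric.ball_subset_closedBall
  | succ N ih =>
    refine (support_convolution_subset _).trans ?_
    rintro _ ⟨x, hx, y, hy, rfl⟩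
    have h1 := ih hx
    have h2 := h.support_subset _ hy
    rw [mem_closedBall_zero_iff] at h1 ⊢
    rw [mem_ball_zero_iff] at h2
    rw [Finset.sum_range_succ]
    exact (norm_add_le _ _).trans (add_le_add h1 h2.le)

theorem partialConvolution_hasCompactSupport (h : IsShrinkingDensitySeq X r) (N : ℕ) :
    HasCompactSupport (partialConvolution X N) :=
  HasCompactSupport.of_support_subset_isCompact (isCompact_closedBall _ _)
    (h.partialConvolution_support N)

/-- The densities themselves may jump; one convolution with a bounded factor already produces
continuity, hence the index shift. -/
theorem partialConvolution_continuous (h : IsShrinkingDensitySeq X r) (N : ℕ) :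
    Continuous (partialConvolution X (N + 1)) := by
  induction N with
  | zero =>
    obtain ⟨C, hC⟩ := h.bounded
    exact continuous_convolution_of_bounded (h.integrable 0) (h.integrable 1) hC
  | succ N ih =>
    exact (h.partialConvolution_hasCompactSupport _).continuous_convolution_left _ ih
      (h.integrable _).locallyIntegrable

/-- Each further factor averages over a ball, so `k` of them only see values within the sum of the
`k` radii. -/
theorem dist_partialConvolution_le (h : IsShrinkingDensitySeq X r) {N : ℕ} {c ε : ℝ} (hε : 0 ≤ ε)
    (k : ℕ) (x : EuclideanSpace ℝ (Fin n))
    (hx : ∀ y ∈ Metric.closedBall x (∑ j ∈ Finset.range k, r (N + 1 + j)),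
      dist (partialConvolution X N y) c ≤ ε) :
    dist (partialConvolution X (N + k) x) c ≤ ε := by
  induction k generalizing x with
  | zero => exact hx x (by simp)
  | succ k ih =>
    rw [← add_assoc, partialConvolution_succ_eq]
    refine dist_convolution_le hε (h.support_subset _) (h.nonneg _) (h.integral_eq_one _)
      (h.partialConvolution_integrable _).aestronglyMeasurable fun y hy => ih y fun z hz => hx z ?_
    rw [Metric.mem_closedBall] at hz ⊢
    rw [Metric.mem_ball] at hy
    rw [Finset.sum_range_succ, show N + 1 + k = N + k + 1 by ring]
    linarith [dist_triangle z y x]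

/-- Averaging translates preserves a modulus of continuity, so the one at index 1 serves for all
later indices. -/
theorem partialConvolution_modulus (h : IsShrinkingDensitySeq X r) {δ ε : ℝ}
    (h1 : ∀ x y, dist x y ≤ δ →
      dist (partialConvolution X 1 x) (partialConvolution X 1 y) ≤ ε) (N : ℕ)
    (x y : EuclideanSpace ℝ (Fin n)) (hxy : dist x y ≤ δ) :
    dist (partialConvolution X (N + 1) x) (partialConvolution X (N + 1) y) ≤ ε := by
  induction N generalizing x y with
  | zero => exact h1 x y hxy
  | succ N ih =>
    have hex : ∀ z, Integrable fun t => X (N + 2) t • partialConvolution X (N + 1) (z - t) :=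
      fun z => (h.partialConvolution_hasCompactSupport _).convolutionExists_right
        (ContinuousLinearMap.lsmul ℝ ℝ) (h.integrable _).locallyIntegrable
        (h.partialConvolution_continuous N) z
    rw [partialConvolution_succ_eq, convolution_lsmul, convolution_lsmul, dist_eq_norm,
      ← integral_sub (hex x) (hex y)]
    calc ‖∫ t, (X (N + 2) t • partialConvolution X (N + 1) (x - t) -
          X (N + 2) t • partialConvolution X (N + 1) (y - t))‖
        ≤ ∫ t, X (N + 2) t * ε := by
          refine norm_integral_le_of_norm_le ((h.integrable _).mul_const ε)
            (Eventually.of_forall fun t => ?_)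
          rw [← smul_sub, norm_smul, Real.norm_of_nonneg (h.nonneg _ _), ← dist_eq_norm]
          exact mul_le_mul_of_nonneg_left (ih _ _ (by simpa using hxy)) (h.nonneg _ _)
      _ = ε := by rw [integral_mul_const, h.integral_eq_one, one_mul]

theorem exists_uniform_tail (h : IsShrinkingDensitySeq X r) {ε : ℝ} (hε : 0 < ε) :
    ∃ N₀, ∀ N ≥ N₀, ∀ M ≥ N, ∀ x,
      dist (partialConvolution X M x) (partialConvolution X N x) ≤ ε := by
  -- The partial convolution of index 1 supplies the common modulus; the remaining radii eventually
  -- sum to less than `δ`.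
  obtain ⟨δ, hδ, hδ'⟩ := Metric.uniformContinuous_iff.1
    ((h.partialConvolution_hasCompactSupport 1).uniformContinuous_of_continuous
      (h.partialConvolution_continuous 0)) ε hε
  have htail := (tendsto_sum_nat_add r).eventually_lt_const hδ
  obtain ⟨N₀, hN₀⟩ := eventually_atTop.1 htail
  refine ⟨N₀ + 1, fun N hN M hM x => ?_⟩
  obtain ⟨N, rfl⟩ : ∃ N', N = N' + 1 := ⟨N - 1, by omega⟩
  obtain ⟨k, rfl⟩ := Nat.exists_eq_add_of_le hM
  refine h.dist_partialConvolution_le hε.le k x fun y hy => ?_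
  refine h.partialConvolution_modulus (δ := ∑' j, r (j + (N + 2))) (fun u v huv => ?_) N y x ?_
  · exact (hδ' (huv.trans_lt (hN₀ _ (by omega)))).le
  · refine (Metric.mem_closedBall.1 hy).trans ?_
    have hs : Summable fun j => r (j + (N + 2)) := (summable_nat_add_iff (N + 2)).2 h.summable
    refine le_trans (le_of_eq ?_) (hs.sum_le_tsum (Finset.range k) fun j _ => h.radius_nonneg _)
    exact Finset.sum_congr rfl fun j _ => by congr 1; ring

theorem fourier_partialConvolution (h : IsShrinkingDensitySeq X r) (N : ℕ)
    (k : EuclideanSpace ℝ (Fin n)) :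
    𝓕 (fun x => (partialConvolution X N x : ℂ)) k =
      ∏ j ∈ Finset.range (N + 1), 𝓕 (fun x => (X j x : ℂ)) k := by
  induction N with
  | zero => simp [partialConvolution]
  | succ N ih =>
    rw [Finset.prod_range_succ, ← ih]
    refine Eq.trans ?_ (Real.fourier_mul_convolution_eq
      (h.partialConvolution_integrable N).ofReal (h.integrable (N + 1)).ofReal k)
    refine congrArg (fun F : EuclideanSpace ℝ (Fin n) → ℂ => 𝓕 F k) (funext fun x => ?_)
    rw [partialConvolution, convolution_mul, convolution_mul, ← integral_complex_ofReal]
    simp only [Complex.ofReal_mul]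
    rfl

/-- The infinite convolution of a shrinking sequence of densities. -/
theorem exists_tendstoUniformly (h : IsShrinkingDensitySeq X r) :
    ∃ f : EuclideanSpace ℝ (Fin n) → ℝ, TendstoUniformly (partialConvolution X) f atTop ∧
      Continuous f ∧ HasCompactSupport f ∧ (∀ x, 0 ≤ f x) ∧
      ∀ k, Tendsto (fun N => ∏ j ∈ Finset.range N, 𝓕 (fun x => (X j x : ℂ)) k) atTop
        (𝓝 (𝓕 (fun x => (f x : ℂ)) k)) := by
  have hcau : ∀ x, ∃ y, Tendsto (fun N => partialConvolution X N x) atTop (𝓝 y) := fun x => by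
    refine cauchySeq_tendsto_of_complete (Metric.cauchySeq_iff'.2 fun ε hε => ?_)
    obtain ⟨N, hN⟩ := h.exists_uniform_tail (half_pos hε)
    exact ⟨N, fun M hM => (hN N le_rfl M hM x).trans_lt (half_lt_self hε)⟩
  choose f hf using hcau
  have hunif : TendstoUniformly (partialConvolution X) f atTop := by
    refine Metric.tendstoUniformly_iff.2 fun ε hε => ?_
    obtain ⟨N₀, hN₀⟩ := h.exists_uniform_tail (half_pos hε)
    filter_upwards [eventually_ge_atTop N₀] with N hN x
    refine lt_of_le_of_lt ?_ (half_lt_self hε)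
    refine le_of_tendsto ((hf x).dist tendsto_const_nhds) ?_
    filter_upwards [eventually_ge_atTop N] with M hM using hN₀ N hN M hM x
  have hsupp : Function.support f ⊆ Metric.closedBall 0 (∑' j, r j) := fun x hx => by
    by_contra hx'
    refine hx (tendsto_nhds_unique (hf x) (tendsto_const_nhds.congr fun N => ?_))
    exact (Function.notMem_support.1 fun hN => hx' (h.partialConvolution_support N hN)).symm
  have hcont : Continuous f := hunif.continuous <| Eventually.frequently <| by
    filter_upwards [eventually_ge_atTop 1] with N hN
    obtain ⟨N, rfl⟩ : ∃ N', N = N' + 1 := ⟨N - 1, by omega⟩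
    exact h.partialConvolution_continuous N
  refine ⟨f, hunif, hcont, HasCompactSupport.of_support_subset_isCompact
    (isCompact_closedBall _ _) hsupp, fun x => ge_of_tendsto' (hf x) fun N =>
      h.partialConvolution_nonneg N x, fun k => ?_⟩
  rw [← tendsto_add_atTop_iff_nat 1]
  simp_rw [← h.fourier_partialConvolution, Real.fourier_eq]
  refine tendsto_integral_filter_of_dominated_convergence
    -- A dominating function: eventually the partial convolutions are within 1 of `f`, and all live
    -- on this ball.
    ((Metric.closedBall 0 (∑' j, r j)).indicator fun x => |f x| + 1) ?_ ?_ ?_ ?_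
  · refine Eventually.of_forall fun N => ?_
    exact ((Real.fourierIntegral_convergent_iff k).2
      (h.partialConvolution_integrable N).ofReal).aestronglyMeasurable
  · filter_upwards [Metric.tendstoUniformly_iff.1 hunif 1 one_pos] with N hN
    refine Eventually.of_forall fun x => ?_
    rw [Circle.norm_smul, Complex.norm_real]
    by_cases hx : x ∈ Metric.closedBall 0 (∑' j, r j)
    · rw [indicator_of_mem hx]
      have := hN x
      rw [dist_comm, dist_eq_norm] at this
      have h2 := norm_le_norm_add_norm_sub' (partialConvolution X N x) (f x)
      rw [Real.norm_eq_abs (f x)] at h2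
      linarith
    · rw [indicator_of_notMem hx,
        Function.notMem_support.1 fun hN => hx (h.partialConvolution_support N hN), norm_zero]
  · exact ((hcont.abs.add continuous_const).continuousOn.integrableOn_compact
      (isCompact_closedBall _ _)).integrable_indicator Metric.isClosed_closedBall.measurableSet
  · refine Eventually.of_forall fun x => ?_
    exact ((Complex.continuous_ofReal.tendsto _).comp (hf x)).const_smul _

end IsShrinkingDensitySeq

/-! ### Contraction forced by compatibility -/

section TransWindow

variable {n : ℕ} {A : EuclideanSpace ℝ (Fin n) →ₗ[ℝ] EuclideanSpace ℝ (Fin n)}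
  {Ω : Set (EuclideanSpace ℝ (Fin n))}

theorem isCompact_transWindow (hΩ : IsCompact Ω) (hne : Ω.Nonempty) :
    IsCompact (transWindow A Ω) := by
  have hclosed : IsClosed (transWindow A Ω) := by
    have : transWindow A Ω = ⋂ y ∈ Ω, (fun u => A y + u) ⁻¹' Ω := by
      ext u; simp [transWindow]
    rw [this]
    exact isClosed_biInter fun y _ => hΩ.isClosed.preimage (by fun_prop)
  obtain ⟨y, hy⟩ := hne
  refine (hΩ.image (f := fun z => z - A y) (by fun_prop)).of_isClosed_subset hclosed fun u hu => ?_
  exact ⟨A y + u, hu y hy, by simp⟩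

/-- The point is the image of `y` under the composition of the maps `z ↦ A z + u j`, each of which
preserves `Ω`. -/
theorem sum_pow_add_mem {u : ℕ → EuclideanSpace ℝ (Fin n)} {N : ℕ}
    (hu : ∀ j < N, u j ∈ transWindow A Ω)
    {y : EuclideanSpace ℝ (Fin n)} (hy : y ∈ Ω) :
    ∑ j ∈ Finset.range N, (A ^ j) (u j) + (A ^ N) y ∈ Ω := by
  induction N generalizing y with
  | zero => simpa using hy
  | succ N ih =>
    have := ih (fun j hj => hu j (by omega)) (hu N (by omega) y hy)
    rw [map_add] at this
    rw [Finset.sum_range_succ, pow_succ, Module.End.mul_apply]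
    convert! this using 1
    abel

theorem inner_pow_apply (j : ℕ) (x w : EuclideanSpace ℝ (Fin n)) :
    inner ℝ ((A ^ j) x) w = inner ℝ x ((LinearMap.adjoint A ^ j) w) := by
  induction j generalizing x w with
  | zero => simp
  | succ j ih =>
    rw [pow_succ, Module.End.mul_apply, ih, pow_succ', Module.End.mul_apply,
      LinearMap.adjoint_inner_right]

/-- Compatibility with the window forces the orbits of the adjoint to be summable. -/
theorem summable_norm_adjoint_pow (hΩ : IsCompact Ω) (hne : Ω.Nonempty)
    (hcompat : (interior (transWindow A Ω)).Nonempty) (w : EuclideanSpace ℝ (Fin n)) :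
    Summable fun j => ‖(LinearMap.adjoint A ^ j) w‖ := by
  obtain ⟨u₀, hu₀⟩ := hcompat
  obtain ⟨ε, hε, hball⟩ := Metric.isOpen_iff.1 isOpen_interior u₀ hu₀
  obtain ⟨y, hy⟩ := hne
  set b : ℕ → EuclideanSpace ℝ (Fin n) := fun j => (LinearMap.adjoint A ^ j) w
  set e : ℕ → EuclideanSpace ℝ (Fin n) := fun j => (ε / 2 * ‖b j‖⁻¹) • b j
  -- The perturbation `e j` points along `b j` with length `ε / 2`, so pairing its image with `w`
  -- returns `ε / 2 * ‖b j‖`. If `b j = 0` then `e j = 0`, which is harmless.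
  have he : ∀ j, ‖e j‖ < ε := fun j => by
    rw [norm_smul, norm_mul, norm_inv, norm_norm, mul_assoc, Real.norm_of_nonneg (half_pos hε).le]
    have : ‖b j‖⁻¹ * ‖b j‖ ≤ 1 := inv_mul_le_one
    nlinarith
  have hu : ∀ j, u₀ + e j ∈ transWindow A Ω := fun j =>
    interior_subset (hball (by simpa using he j))
  have hinner : ∀ j, inner ℝ ((A ^ j) (e j)) w = ε / 2 * ‖b j‖ := fun j => by
    rw [inner_pow_apply]
    change inner ℝ (e j) (b j) = _
    rw [real_inner_smul_left, real_inner_self_eq_norm_sq]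
    rcases eq_or_ne ‖b j‖ 0 with h | h
    · simp [h]
    · field_simp
  refine summable_of_sum_range_le (c := (ε / 2)⁻¹ * (Metric.diam Ω * ‖w‖))
    (fun j => norm_nonneg _) fun N => ?_
  rw [← div_eq_inv_mul, le_div_iff₀' (half_pos hε), Finset.mul_sum]
  -- The perturbed and the unperturbed orbit both end in `Ω`; their difference is at most the
  -- diameter, uniformly in `N`.
  calc ∑ j ∈ Finset.range N, ε / 2 * ‖b j‖
      = inner ℝ ((∑ j ∈ Finset.range N, (A ^ j) (u₀ + e j) + (A ^ N) y) -
          (∑ j ∈ Finset.range N, (A ^ j) u₀ + (A ^ N) y)) w := by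
        rw [add_sub_add_right_eq_sub, ← Finset.sum_sub_distrib, sum_inner]
        refine Finset.sum_congr rfl fun j _ => ?_
        rw [map_add, add_sub_cancel_left, hinner]
    _ ≤ ‖(∑ j ∈ Finset.range N, (A ^ j) (u₀ + e j) + (A ^ N) y) -
          (∑ j ∈ Finset.range N, (A ^ j) u₀ + (A ^ N) y)‖ * ‖w‖ := real_inner_le_norm _ _
    _ ≤ Metric.diam Ω * ‖w‖ := by
        rw [← dist_eq_norm]
        exact mul_le_mul_of_nonneg_right (Metric.dist_le_diam_of_mem hΩ.isBounded
          (sum_pow_add_mem (fun j _ => hu j) hy)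
          (sum_pow_add_mem (fun j _ => interior_subset hu₀) hy)) (norm_nonneg _)

/-- The coordinates of `A^j x` are inner products of `x` with the adjoint orbits of the basis
vectors, whose norms are summable. -/
theorem exists_summable_norm_pow_le (hΩ : IsCompact Ω) (hne : Ω.Nonempty)
    (hcompat : (interior (transWindow A Ω)).Nonempty) :
    ∃ a : ℕ → ℝ, Summable a ∧ (∀ j, 0 ≤ a j) ∧ ∀ j x, ‖(A ^ j) x‖ ≤ a j * ‖x‖ := by
  set e := EuclideanSpace.basisFun (Fin n) ℝ
  refine ⟨fun j => ∑ i, ‖(LinearMap.adjoint A ^ j) (e i)‖,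
    summable_sum fun i _ => summable_norm_adjoint_pow hΩ hne hcompat (e i),
    fun j => Finset.sum_nonneg fun i _ => norm_nonneg _, fun j x => ?_⟩
  rw [← e.sum_repr' ((A ^ j) x), Finset.sum_mul]
  refine (norm_sum_le _ _).trans (Finset.sum_le_sum fun i _ => ?_)
  rw [norm_smul, e.orthonormal.norm_eq_one, mul_one, real_inner_comm, inner_pow_apply, mul_comm]
  exact norm_inner_le_norm _ _

end TransWindow

/-! ### Normalized indicators of compact sets -/

section NormIndicator

variable {n : ℕ} {K : Set (EuclideanSpace ℝ (Fin n))}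

theorem normIndicator_nonneg (x : EuclideanSpace ℝ (Fin n)) : 0 ≤ normIndicator K x :=
  indicator_nonneg (fun _ _ => inv_nonneg.2 measureReal_nonneg) x

theorem normIndicator_le (x : EuclideanSpace ℝ (Fin n)) :
    |normIndicator K x| ≤ (volume.real K)⁻¹ := by
  rw [abs_of_nonneg (normIndicator_nonneg x)]
  exact indicator_le_self' (fun _ _ => inv_nonneg.2 measureReal_nonneg) x

theorem volume_real_pos_of_interior_nonempty (hK : IsCompact K) (hint : (interior K).Nonempty) :
    0 < volume.real K := by
  refine ENNReal.toReal_pos (ne_of_gt ?_) hK.measure_lt_top.ne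
  exact (isOpen_interior.measure_pos _ hint).trans_le (measure_mono interior_subset)

theorem integral_normIndicator (hK : IsCompact K) (hpos : 0 < volume.real K) :
    ∫ x, normIndicator K x = 1 := by
  simp only [normIndicator]
  rw [integral_indicator hK.isClosed.measurableSet, setIntegral_const, smul_eq_mul,
    mul_inv_cancel₀ hpos.ne']

theorem integrable_normIndicator (hK : IsCompact K) (hpos : 0 < volume.real K) :
    Integrable (normIndicator K) :=
  integrable_of_integral_eq_one (integral_normIndicator hK hpos)

theorem support_normIndicator_subset : Function.support (normIndicator K) ⊆ K :=
  support_indicator_subset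

theorem volume_real_image (A : EuclideanSpace ℝ (Fin n) →ₗ[ℝ] EuclideanSpace ℝ (Fin n)) :
    volume.real (A '' K) = |LinearMap.det A| * volume.real K := by
  rw [Measure.real, Measure.addHaar_image_linearMap, ENNReal.toReal_mul,
    ENNReal.toReal_ofReal (abs_nonneg _), Measure.real]

theorem normIndicator_image (B : EuclideanSpace ℝ (Fin n) ≃ₗ[ℝ] EuclideanSpace ℝ (Fin n))
    (x : EuclideanSpace ℝ (Fin n)) :
    normIndicator (B '' K) x =
      |LinearMap.det (B : EuclideanSpace ℝ (Fin n) →ₗ[ℝ] EuclideanSpace ℝ (Fin n))|⁻¹ *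
        normIndicator K (B.symm x) := by
  have hmem : x ∈ B '' K ↔ B.symm x ∈ K := by
    constructor
    · rintro ⟨y, hy, rfl⟩; simpa using hy
    · exact fun h => ⟨_, h, by simp⟩
  have hvol := volume_real_image (K := K)
    (B : EuclideanSpace ℝ (Fin n) →ₗ[ℝ] EuclideanSpace ℝ (Fin n))
  rw [LinearEquiv.coe_coe] at hvol
  by_cases h : B.symm x ∈ K
  · rw [normIndicator, normIndicator, indicator_of_mem h, indicator_of_mem (hmem.2 h), hvol,
      mul_inv]
  · rw [normIndicator, normIndicator, indicator_of_notMem h,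
      indicator_of_notMem (mt hmem.1 h), mul_zero]

end NormIndicator

/-! ### Fourier transform and linear changes of variable -/

section FourierScaling

variable {n : ℕ} (B : EuclideanSpace ℝ (Fin n) ≃ₗ[ℝ] EuclideanSpace ℝ (Fin n))

theorem integral_comp_linearEquiv {F : Type*} [NormedAddCommGroup F] [NormedSpace ℝ F]
    (g : EuclideanSpace ℝ (Fin n) → F) :
    ∫ x, g (B x) =
      |LinearMap.det (B : EuclideanSpace ℝ (Fin n) →ₗ[ℝ] EuclideanSpace ℝ (Fin n))|⁻¹ •
        ∫ x, g x := by
  have hdet : LinearMap.det (B : EuclideanSpace ℝ (Fin n) →ₗ[ℝ] EuclideanSpace ℝ (Fin n)) ≠ 0 :=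
    B.isUnit_det'.ne_zero
  have hmap := Measure.map_linearMap_addHaar_eq_smul_addHaar
    (volume : Measure (EuclideanSpace ℝ (Fin n))) hdet
  have hemb : MeasurableEmbedding
      (B : EuclideanSpace ℝ (Fin n) →ₗ[ℝ] EuclideanSpace ℝ (Fin n)) :=
    B.toContinuousLinearEquiv.toHomeomorph.measurableEmbedding
  have := hemb.integral_map (μ := volume) g
  rw [hmap, integral_smul_measure, ENNReal.toReal_ofReal (abs_nonneg _), abs_inv] at this
  exact this.symm

theorem fourier_comp_symm (g : EuclideanSpace ℝ (Fin n) → ℂ) (k : EuclideanSpace ℝ (Fin n)) :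
    𝓕 (fun x => ((|LinearMap.det
        (B : EuclideanSpace ℝ (Fin n) →ₗ[ℝ] EuclideanSpace ℝ (Fin n))|⁻¹ : ℝ) : ℂ) *
        g (B.symm x)) k =
      𝓕 g (LinearMap.adjoint
        (B : EuclideanSpace ℝ (Fin n) →ₗ[ℝ] EuclideanSpace ℝ (Fin n)) k) := by
  set d := |LinearMap.det (B : EuclideanSpace ℝ (Fin n) →ₗ[ℝ] EuclideanSpace ℝ (Fin n))|
  rw [Real.fourier_eq, Real.fourier_eq]
  have hd : d ≠ 0 := abs_ne_zero.2 B.isUnit_det'.ne_zero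
  have h := integral_comp_linearEquiv B fun x =>
    Real.fourierChar (-inner ℝ x k) • (((d⁻¹ : ℝ) : ℂ) * g (B.symm x))
  rw [eq_comm, inv_smul_eq_iff₀ hd] at h
  rw [h, ← integral_smul]
  refine integral_congr_ae (Eventually.of_forall fun x => ?_)
  simp only [LinearEquiv.symm_apply_apply]
  rw [LinearMap.adjoint_inner_right, LinearEquiv.coe_coe, ← Complex.real_smul, smul_comm,
    smul_inv_smul₀ hd]

theorem fourier_normIndicator_image (K : Set (EuclideanSpace ℝ (Fin n)))
    (k : EuclideanSpace ℝ (Fin n)) :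
    𝓕 (fun x => (normIndicator (B '' K) x : ℂ)) k =
      𝓕 (fun x => (normIndicator K x : ℂ)) (LinearMap.adjoint
        (B : EuclideanSpace ℝ (Fin n) →ₗ[ℝ] EuclideanSpace ℝ (Fin n)) k) := by
  rw [← fourier_comp_symm]
  simp only [normIndicator_image, Complex.ofReal_mul]

end FourierScaling

/-! ### Fourier estimates, inversion and smoothness -/

section Fourier

variable {n : ℕ}

theorem continuous_fourier_of_integrable {g : EuclideanSpace ℝ (Fin n) → ℂ} (hg : Integrable g) :
    Continuous (𝓕 g) :=
  VectorFourier.fourierIntegral_continuous Real.continuous_fourierChar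
    (L := innerₗ (EuclideanSpace ℝ (Fin n))) continuous_inner hg

theorem fourier_zero_eq (g : EuclideanSpace ℝ (Fin n) → ℝ) :
    𝓕 (fun x => (g x : ℂ)) 0 = ((∫ x, g x : ℝ) : ℂ) := by
  rw [Real.fourier_eq, ← integral_complex_ofReal]
  simp

/-- From `|e^{iθ} - 1| ≤ |θ|` on the support. Linearity in `‖k‖` turns summability of the adjoint
orbit into absolute convergence of the product. -/
theorem norm_fourier_sub_one_le {g : EuclideanSpace ℝ (Fin n) → ℝ} {R : ℝ}
    (hg0 : ∀ x, 0 ≤ g x) (hg1 : ∫ x, g x = 1) (hR : ∀ x, g x ≠ 0 → ‖x‖ ≤ R)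
    (k : EuclideanSpace ℝ (Fin n)) :
    ‖𝓕 (fun x => (g x : ℂ)) k - 1‖ ≤ 2 * Real.pi * R * ‖k‖ := by
  have hgi : Integrable g := integrable_of_integral_eq_one hg1
  have h1 : (1 : ℂ) = ∫ x, (g x : ℂ) := by rw [integral_complex_ofReal, hg1]; simp
  rw [Real.fourier_eq, h1,
    ← integral_sub ((Real.fourierIntegral_convergent_iff k).2 hgi.ofReal) hgi.ofReal]
  calc _ ≤ ∫ x, 2 * Real.pi * R * ‖k‖ * g x := by
        refine norm_integral_le_of_norm_le (hgi.const_mul _) (Eventually.of_forall fun x => ?_)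
        rcases eq_or_ne (g x) 0 with h0 | h0
        · simp [h0]
        have hx := hR x h0
        rw [Circle.smul_def, smul_eq_mul]
        rw [← sub_one_mul, norm_mul, Complex.norm_real, Real.norm_of_nonneg (hg0 x)]
        refine mul_le_mul_of_nonneg_right ?_ (hg0 x)
        rw [Real.fourierChar_apply, mul_comm _ Complex.I]
        refine Real.norm_exp_I_mul_ofReal_sub_one_le.trans ?_
        rw [norm_mul, norm_neg, Real.norm_of_nonneg (by positivity), mul_assoc, mul_assoc,
          mul_assoc]
        gcongr
        exact (norm_inner_le_norm x k).trans (by gcongr)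
    _ = _ := by rw [integral_const_mul, hg1, mul_one]

/-- A continuous integrable function whose Fourier transform decays rapidly is smooth. -/
theorem contDiff_of_rapid_decay_fourier {f : EuclideanSpace ℝ (Fin n) → ℂ} (hc : Continuous f)
    (hi : Integrable f) (hd : ∀ M : ℕ, ∃ C, ∀ k, ‖k‖ ^ M * ‖𝓕 f k‖ ≤ C) :
    Integrable (𝓕 f) ∧ ContDiff ℝ ∞ f := by
  have hint : ∀ M : ℕ, Integrable fun k => ‖k‖ ^ M * ‖𝓕 f k‖ := fun M => by
    obtain ⟨C₁, hC₁⟩ := hd 0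
    obtain ⟨C₂, hC₂⟩ := hd (M + (volume : Measure (EuclideanSpace ℝ (Fin n))).integrablePower)
    exact integrable_of_le_of_pow_mul_le (fun k => by simpa using hC₁ k) hC₂
      (continuous_fourier_of_integrable hi).aestronglyMeasurable
  have hF : Integrable (𝓕 f) :=
    (integrable_norm_iff (continuous_fourier_of_integrable hi).aestronglyMeasurable).1
      (by simpa using hint 0)
  refine ⟨hF, ?_⟩
  have hinv := hc.fourierInv_fourier_eq hi hF
  have h2 : ContDiff ℝ ∞ (𝓕 (𝓕 f)) := Real.contDiff_fourier (N := ⊤) fun M _ => hint M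
  rw [← hinv]
  have : 𝓕⁻ (𝓕 f) = fun x => 𝓕 (𝓕 f) (-x) := funext fun x => Real.fourierInv_eq_fourier_neg _ _
  rw [this]
  exact h2.comp contDiff_neg

theorem eq_of_fourier_eq {f g : EuclideanSpace ℝ (Fin n) → ℂ} (hf : Continuous f)
    (hfi : Integrable f) (hg : Continuous g) (hgi : Integrable g) (hF : Integrable (𝓕 f))
    (h : 𝓕 g = 𝓕 f) : g = f := by
  rw [← hf.fourierInv_fourier_eq hfi hF, ← hg.fourierInv_fourier_eq hgi (h ▸ hF), h]

/-- A bounded solution of `φ(k) = X(k) φ(B k)`, where `X` vanishes at infinity and `B` is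
invertible with all orbits tending to zero, decays rapidly. -/
theorem rapid_decay_of_refinement {φ X : EuclideanSpace ℝ (Fin n) → ℂ}
    {B : EuclideanSpace ℝ (Fin n) →ₗ[ℝ] EuclideanSpace ℝ (Fin n)}
    (hφ : ∀ k, ‖φ k‖ ≤ 1) (hX : Tendsto X (cocompact _) (𝓝 0))
    (heq : ∀ k, φ k = X k * φ (B k)) {c : ℝ} (hc : 0 < c) (hB : ∀ k, ‖k‖ ≤ c * ‖B k‖)
    (hlim : ∀ k, Tendsto (fun j => (B ^ j) k) atTop (𝓝 0)) (M : ℕ) :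
    ∃ C, ∀ k, ‖k‖ ^ M * ‖φ k‖ ≤ C := by
  -- The threshold `(c ^ M)⁻¹` exactly offsets the growth `‖k‖ ^ M ≤ c ^ M * ‖B k‖ ^ M` in one
  -- application of the equation.
  have hsmall : ∀ᶠ k in cocompact (EuclideanSpace ℝ (Fin n)), ‖X k‖ ≤ (c ^ M)⁻¹ :=
    (tendsto_zero_iff_norm_tendsto_zero.1 hX).eventually_le_const (by positivity)
  obtain ⟨R, hR0, hR⟩ : ∃ R : ℝ, 0 < R ∧ ∀ k, R ≤ ‖k‖ → ‖X k‖ ≤ (c ^ M)⁻¹ := by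
    rw [← Metric.cobounded_eq_cocompact, ← comap_norm_atTop, eventually_comap] at hsmall
    obtain ⟨R, hR⟩ := eventually_atTop.1 hsmall
    exact ⟨max R 1, by positivity, fun k hk => hR _ ((le_max_left _ _).trans hk) k rfl⟩
  refine ⟨R ^ M, fun k => ?_⟩
  -- Outside the ball of radius `R`, passing from `k` to `B k` does not decrease `‖k‖ ^ M * ‖φ k‖`.
  -- Follow the orbit until it enters the ball, where the bound is immediate.
  have key : ∀ (j : ℕ) k, ‖(B ^ j) k‖ < R → ‖k‖ ^ M * ‖φ k‖ ≤ R ^ M := by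
    have hbase : ∀ k, ‖k‖ < R → ‖k‖ ^ M * ‖φ k‖ ≤ R ^ M := fun k hk =>
      (mul_le_of_le_one_right (by positivity) (hφ k)).trans (by gcongr)
    intro j
    induction j with
    | zero => exact fun k hk => hbase k hk
    | succ j ih =>
      intro k hk
      rcases lt_or_ge ‖k‖ R with h | h
      · exact hbase k h
      rw [pow_succ, Module.End.mul_apply] at hk
      refine le_trans ?_ (ih (B k) hk)
      rw [heq k, norm_mul]
      calc ‖k‖ ^ M * (‖X k‖ * ‖φ (B k)‖)
          ≤ (c * ‖B k‖) ^ M * ((c ^ M)⁻¹ * ‖φ (B k)‖) := by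
            gcongr
            · exact hB k
            · exact hR k h
        _ = ‖B k‖ ^ M * ‖φ (B k)‖ := by
            rw [mul_pow]
            field_simp
  obtain ⟨j, hj⟩ := ((tendsto_zero_iff_norm_tendsto_zero.1 (hlim k)).eventually_lt_const hR0).exists
  exact key j k hj

end Fourier

/-! ### The refinement equation and its solution -/

section Refinement

variable {n : ℕ} (A : EuclideanSpace ℝ (Fin n) ≃ₗ[ℝ] EuclideanSpace ℝ (Fin n))
  {Ω : Set (EuclideanSpace ℝ (Fin n))}

theorem coe_linearEquiv_pow (N : ℕ) :
    (A ^ N).toLinearMap = A.toLinearMap ^ N := by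
  ext1 x
  rw [LinearEquiv.coe_coe, LinearEquiv.pow_apply, Module.End.pow_apply, LinearEquiv.coe_coe]

theorem adjoint_pow (B : EuclideanSpace ℝ (Fin n) →ₗ[ℝ] EuclideanSpace ℝ (Fin n)) (N : ℕ) :
    LinearMap.adjoint (B ^ N) = LinearMap.adjoint B ^ N := by
  rw [← LinearMap.star_eq_adjoint, ← LinearMap.star_eq_adjoint, star_pow]

theorem image_pow_eq (N : ℕ) (K : Set (EuclideanSpace ℝ (Fin n))) :
    (A.toLinearMap ^ N) '' K =
      (A ^ N : EuclideanSpace ℝ (Fin n) ≃ₗ[ℝ] EuclideanSpace ℝ (Fin n)) '' K := by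
  rw [← coe_linearEquiv_pow, LinearEquiv.coe_coe]

/-- The normalized indicator functions of `A ^ N Ω_Q`. -/
noncomputable def scaledIndicators (B : EuclideanSpace ℝ (Fin n) →ₗ[ℝ] EuclideanSpace ℝ (Fin n))
    (Ω : Set (EuclideanSpace ℝ (Fin n))) (N : ℕ) : EuclideanSpace ℝ (Fin n) → ℝ :=
  normIndicator (⇑(B ^ N) '' transWindow B Ω)

theorem fourier_scaledIndicators (N : ℕ) (k : EuclideanSpace ℝ (Fin n)) :
    𝓕 (fun x => (scaledIndicators A.toLinearMap Ω N x : ℂ)) k =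
      𝓕 (fun x => (normIndicator (transWindow A.toLinearMap Ω) x : ℂ))
        ((LinearMap.adjoint A.toLinearMap ^ N) k) := by
  rw [scaledIndicators, image_pow_eq, fourier_normIndicator_image, coe_linearEquiv_pow,
    adjoint_pow]

theorem isShrinkingDensitySeq_scaledIndicators (hΩ : IsCompact Ω) (hne : Ω.Nonempty)
    (hcompat : (interior (transWindow A.toLinearMap Ω)).Nonempty) :
    ∃ r, IsShrinkingDensitySeq
      (scaledIndicators A.toLinearMap Ω) r := by
  obtain ⟨a, ha, ha0, haA⟩ := exists_summable_norm_pow_le hΩ hne hcompat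
  have hK := isCompact_transWindow (A := A.toLinearMap) hΩ hne
  have hvol := volume_real_pos_of_interior_nonempty hK hcompat
  obtain ⟨C, hC0, hC⟩ := hK.isBounded.exists_pos_norm_le
  have hKN : ∀ N : ℕ, IsCompact ((A.toLinearMap ^ N) ''
      transWindow A.toLinearMap Ω) := fun N =>
    hK.image (LinearMap.continuous_of_finiteDimensional (A.toLinearMap ^ N))
  have hvolN : ∀ N : ℕ, 0 < volume.real ((A.toLinearMap ^ N) ''
      transWindow A.toLinearMap Ω) := fun N => by
    rw [volume_real_image, map_pow]
    exact mul_pos (abs_pos.2 (pow_ne_zero _ A.isUnit_det'.ne_zero)) hvol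
  -- The summand `(1 / 2) ^ j` keeps the radii positive, so the supports lie in open balls.
  refine ⟨fun j => a j * C + (1 / 2) ^ j, fun j x => normIndicator_nonneg x,
    fun j => integral_normIndicator (hKN j) (hvolN j), fun j x hx => ?_,
    fun j => by have := ha0 j; positivity,
    (ha.mul_right C).add summable_geometric_two, ⟨_, normIndicator_le⟩⟩
  obtain ⟨u, hu, rfl⟩ := support_normIndicator_subset hx
  rw [mem_ball_zero_iff]
  calc _ ≤ a j * ‖u‖ := haA j u
    _ ≤ a j * C := mul_le_mul_of_nonneg_left (hC u hu) (ha0 j)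
    _ < _ := lt_add_of_pos_right _ (by positivity)

/-- Supports add, so such a point has the form in `sum_pow_add_mem` up to the term `A^(N+1) y`,
which tends to zero. This places the support of the limit in `Ω`. -/
theorem exists_sum_of_partialConvolution_ne_zero
    (B : EuclideanSpace ℝ (Fin n) →ₗ[ℝ] EuclideanSpace ℝ (Fin n)) (N : ℕ)
    (x : EuclideanSpace ℝ (Fin n)) (hx : partialConvolution (scaledIndicators B Ω) N x ≠ 0) :
    ∃ u : ℕ → EuclideanSpace ℝ (Fin n), (∀ j < N + 1, u j ∈ transWindow B Ω) ∧
      x = ∑ j ∈ Finset.range (N + 1), (B ^ j) (u j) := by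
  induction N generalizing x with
  | zero =>
    obtain ⟨u, hu, rfl⟩ := support_normIndicator_subset hx
    exact ⟨fun _ => u, fun _ _ => hu, by simp⟩
  | succ N ih =>
    obtain ⟨y, hy, z, hz, rfl⟩ := support_convolution_subset _ hx
    obtain ⟨u, hu, rfl⟩ := ih y hy
    obtain ⟨v, hv, rfl⟩ := support_normIndicator_subset hz
    refine ⟨Function.update u (N + 1) v, fun j hj => ?_, ?_⟩
    · rcases eq_or_ne j (N + 1) with rfl | h
      · simpa using hv
      · simpa [h] using hu j (by omega)
    · rw [Finset.sum_range_succ _ (N + 1), Function.update_self]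
      refine congrArg₂ _ (Finset.sum_congr rfl fun j hj => ?_) rfl
      rw [Function.update_of_ne (by have := Finset.mem_range.1 hj; omega)]

/-- The operator `g ↦ X_{Ω_Q} ⋆ (|det A|⁻¹ g ∘ A⁻¹)`. -/
noncomputable def refinementOperator (Ω : Set (EuclideanSpace ℝ (Fin n))) (g : EuclideanSpace ℝ (Fin n) → ℝ) :
    EuclideanSpace ℝ (Fin n) → ℝ :=
  normIndicator (transWindow A.toLinearMap Ω)
    ⋆[ContinuousLinearMap.mul ℝ ℝ, volume] fun y =>
      |LinearMap.det A.toLinearMap|⁻¹ *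
        g (A.symm y)

section

variable {g : EuclideanSpace ℝ (Fin n) → ℝ}

theorem continuous_rescale (hg : Continuous g) : Continuous fun y =>
    |LinearMap.det A.toLinearMap|⁻¹ *
        g (A.symm y) :=
  continuous_const.mul
    (hg.comp A.symm.toContinuousLinearEquiv.continuous)

theorem hasCompactSupport_rescale (hgc : HasCompactSupport g) : HasCompactSupport fun y =>
    |LinearMap.det A.toLinearMap|⁻¹ *
        g (A.symm y) :=
  (hgc.comp_homeomorph A.symm.toContinuousLinearEquiv.toHomeomorph).mul_left

theorem continuous_refinementOperator
    (hK : IsCompact (transWindow A.toLinearMap Ω))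
    (hvol : 0 < volume.real (transWindow A.toLinearMap Ω))
    (hg : Continuous g) (hgc : HasCompactSupport g) :
    Continuous (refinementOperator A Ω g) :=
  (hasCompactSupport_rescale A hgc).continuous_convolution_right _
    (integrable_normIndicator hK hvol).locallyIntegrable (continuous_rescale A hg)

theorem integrable_refinementOperator
    (hK : IsCompact (transWindow A.toLinearMap Ω))
    (hvol : 0 < volume.real (transWindow A.toLinearMap Ω))
    (hg : Continuous g) (hgc : HasCompactSupport g) :
    Integrable (refinementOperator A Ω g) :=
  (integrable_normIndicator hK hvol).integrable_convolution _
    ((continuous_rescale A hg).integrable_of_hasCompactSupport (hasCompactSupport_rescale A hgc))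

theorem fourier_refinementOperator
    (hK : IsCompact (transWindow A.toLinearMap Ω))
    (hvol : 0 < volume.real (transWindow A.toLinearMap Ω))
    (hg : Continuous g) (hgc : HasCompactSupport g) (k : EuclideanSpace ℝ (Fin n)) :
    𝓕 (fun x => (refinementOperator A Ω g x : ℂ)) k =
      𝓕 (fun x => (normIndicator (transWindow A.toLinearMap Ω) x : ℂ)) k *
        𝓕 (fun x => (g x : ℂ)) (LinearMap.adjoint A.toLinearMap k) := by
  rw [← fourier_comp_symm]
  have hi := (continuous_rescale A hg).integrable_of_hasCompactSupport (μ := volume)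
    (hasCompactSupport_rescale A hgc)
  have := Real.fourier_mul_convolution_eq (integrable_normIndicator hK hvol).ofReal
    (hi.ofReal (𝕜 := ℂ)) k
  simp only [RCLike.ofReal_mul] at this
  refine Eq.trans ?_ this
  refine congrArg (fun F : EuclideanSpace ℝ (Fin n) → ℂ => 𝓕 F k) (funext fun x => ?_)
  rw [refinementOperator, convolution_mul, convolution_mul, ← integral_complex_ofReal]
  simp only [Complex.ofReal_mul]
  rfl

end

theorem tendsto_adjoint_pow (hΩ : IsCompact Ω) (hne : Ω.Nonempty)
    (hcompat : (interior (transWindow A.toLinearMap Ω)).Nonempty)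
    (k : EuclideanSpace ℝ (Fin n)) :
    Tendsto (fun j => (LinearMap.adjoint A.toLinearMap ^ j) k) atTop
      (𝓝 0) :=
  tendsto_zero_iff_norm_tendsto_zero.2
    (summable_norm_adjoint_pow hΩ hne hcompat k).tendsto_atTop_zero

/-- The adjoint of the inverse inverts the adjoint; its operator norm, increased by 1 for
positivity, is the constant. -/
theorem exists_norm_le_mul_norm_adjoint :
    ∃ c : ℝ, 0 < c ∧ ∀ k,
      ‖k‖ ≤ c * ‖LinearMap.adjoint A.toLinearMap k‖ := by
  set D := LinearMap.toContinuousLinearMap (LinearMap.adjoint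
    A.symm.toLinearMap)
  refine ⟨‖D‖ + 1, by positivity, fun k => ?_⟩
  have hk : D (LinearMap.adjoint A.toLinearMap k) = k := by
    refine ext_inner_left ℝ fun v => ?_
    change inner ℝ v (LinearMap.adjoint _ _) = _
    rw [LinearMap.adjoint_inner_right, LinearMap.adjoint_inner_right]
    simp
  calc ‖k‖ = ‖D (LinearMap.adjoint A.toLinearMap k)‖ := by rw [hk]
    _ ≤ ‖D‖ * _ := D.le_opNorm _
    _ ≤ _ := by gcongr; linarith

/-- Existence and properties of the infinite convolution of the functions `X_{A ^ N Ω_Q}`. -/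
theorem exists_refinement_density (hΩ : IsCompact Ω) (hne : Ω.Nonempty)
    (hcompat : (interior (transWindow A.toLinearMap Ω)).Nonempty) :
    ∃ f : EuclideanSpace ℝ (Fin n) → ℝ,
      (ContDiff ℝ ∞ f ∧ tsupport f ⊆ Ω ∧ (∀ u, 0 ≤ f u) ∧ ∫ u, f u = 1) ∧
      TendstoUniformly (partialConvolution
        (scaledIndicators A.toLinearMap Ω)) f atTop ∧
      (∀ k, HasProd (fun N : ℕ => 𝓕 (fun u =>
          (normIndicator (transWindow A.toLinearMap Ω) u : ℂ))
          ((LinearMap.adjoint A.toLinearMap ^ N) k))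
        (𝓕 (fun u => (f u : ℂ)) k)) ∧
      Integrable (𝓕 fun u => (f u : ℂ)) ∧ refinementOperator A Ω f = f := by
  obtain ⟨r, hr⟩ := isShrinkingDensitySeq_scaledIndicators A hΩ hne hcompat
  have hK := isCompact_transWindow (A := A.toLinearMap) hΩ hne
  have hvol := volume_real_pos_of_interior_nonempty hK hcompat
  obtain ⟨f, hunif, hcont, hsupp, hnonneg, hprod⟩ := hr.exists_tendstoUniformly
  simp_rw [fourier_scaledIndicators] at hprod
  have hfi : Integrable f := hcont.integrable_of_hasCompactSupport hsupp
  have hone : ∫ u, f u = 1 := by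
    have h0 := hprod 0
    simp only [map_zero, fourier_zero_eq, integral_normIndicator hK hvol, Complex.ofReal_one,
      Finset.prod_const_one] at h0
    exact_mod_cast (tendsto_nhds_unique tendsto_const_nhds h0).symm
  have hhas : ∀ k, HasProd (fun N : ℕ => 𝓕 (fun u =>
      (normIndicator (transWindow A.toLinearMap Ω) u : ℂ))
      ((LinearMap.adjoint A.toLinearMap ^ N) k))
      (𝓕 (fun u => (f u : ℂ)) k) := fun k => by
    obtain ⟨R, hR0, hR⟩ := hK.isBounded.exists_pos_norm_le
    have hm : Multipliable fun N : ℕ => 𝓕 (fun u =>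
      (normIndicator (transWindow A.toLinearMap Ω) u : ℂ))
      ((LinearMap.adjoint A.toLinearMap ^ N) k) := by
      have hs : Summable fun N : ℕ => 𝓕 (fun u =>
        (normIndicator (transWindow A.toLinearMap Ω) u : ℂ))
        ((LinearMap.adjoint A.toLinearMap ^ N) k) - 1 :=
        ((summable_norm_adjoint_pow hΩ hne hcompat k).mul_left _).of_norm_bounded fun N =>
          norm_fourier_sub_one_le normIndicator_nonneg (integral_normIndicator hK hvol)
            (fun x hx => hR x (support_normIndicator_subset hx)) _
      simpa using Complex.multipliable_one_add_of_summable hs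
    have := hm.hasProd
    rwa [tendsto_nhds_unique this.tendsto_prod_nat (hprod k)] at this
  have heq : ∀ k, 𝓕 (fun u => (f u : ℂ)) k = 𝓕 (fun u =>
      (normIndicator (transWindow A.toLinearMap Ω) u : ℂ)) k *
      𝓕 (fun u => (f u : ℂ)) (LinearMap.adjoint A.toLinearMap k) :=
    fun k => by
    -- Splitting off the factor `N = 0` leaves the same product evaluated at `Aᵗ k`.
    refine tendsto_nhds_unique ((tendsto_add_atTop_iff_nat 1).2 (hprod k)) ?_
    simp_rw [Finset.prod_range_succ']
    rw [mul_comm]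
    refine Tendsto.mul ?_ (by simp)
    convert! hprod (LinearMap.adjoint A.toLinearMap k) using 4
  have hcontC : Continuous fun u => (f u : ℂ) := Complex.continuous_ofReal.comp hcont
  have hle : ∀ k, ‖𝓕 (fun u => (f u : ℂ)) k‖ ≤ 1 := fun k => by
    rw [← hone, Real.fourier_eq]
    refine (norm_integral_le_integral_norm _).trans_eq (integral_congr_ae
      (Eventually.of_forall fun x => ?_))
    simp only [Circle.norm_smul, Complex.norm_real, Real.norm_of_nonneg (hnonneg x)]
  obtain ⟨c, hc0, hc⟩ := exists_norm_le_mul_norm_adjoint A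
  obtain ⟨hFi, hsmooth⟩ := contDiff_of_rapid_decay_fourier hcontC hfi.ofReal
    (rapid_decay_of_refinement hle (tendsto_integral_exp_inner_smul_cocompact _) heq hc0 hc
      (tendsto_adjoint_pow A hΩ hne hcompat))
  refine ⟨f, ⟨?_, ?_, hnonneg, hone⟩, hunif, hhas, hFi, ?_⟩
  · exact Complex.reCLM.contDiff.comp hsmooth
  · refine closure_minimal (fun x hx => ?_) hΩ.isClosed
    obtain ⟨y, hy⟩ := hne
    obtain ⟨a, ha, ha0, haA⟩ := exists_summable_norm_pow_le hΩ ⟨y, hy⟩ hcompat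
    have hev : ∀ᶠ N in atTop, partialConvolution
        (scaledIndicators A.toLinearMap Ω) N x ≠ 0 :=
      (hunif.tendsto_at x).eventually_ne hx
    -- The points `x + A^(N+1) y` lie in `Ω` for large `N` and converge to `x`.
    refine hΩ.isClosed.mem_of_tendsto (f := fun N =>
      x + (A.toLinearMap ^ (N + 1)) y) (b := atTop) ?_ ?_
    · conv => rhs; rw [← add_zero x]
      refine tendsto_const_nhds.add (squeeze_zero_norm (fun N => haA (N + 1) y) ?_)
      simpa using ((tendsto_add_atTop_iff_nat 1).2 ha.tendsto_atTop_zero).mul_const ‖y‖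
    · filter_upwards [hev] with N hN
      obtain ⟨u, hu, hxu⟩ := exists_sum_of_partialConvolution_ne_zero _ N x hN
      rw [hxu]
      exact sum_pow_add_mem hu hy
  · have := eq_of_fourier_eq hcontC hfi.ofReal
      (Complex.continuous_ofReal.comp (continuous_refinementOperator A hK hvol hcont hsupp))
      (integrable_refinementOperator A hK hvol hcont hsupp).ofReal hFi
      (funext fun k => (fourier_refinementOperator A hK hvol hcont hsupp k).trans (heq k).symm)
    exact funext fun x => Complex.ofReal_injective (congrFun this x)

/-- The infinite convolution is the only normalized fixed point of the refinement operator. -/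
theorem eq_of_refinementOperator_eq (hΩ : IsCompact Ω) (hne : Ω.Nonempty)
    (hcompat : (interior (transWindow A.toLinearMap Ω)).Nonempty)
    {f g : EuclideanSpace ℝ (Fin n) → ℝ} (hf : Continuous f) (hfc : HasCompactSupport f)
    (hF : Integrable (𝓕 fun u => (f u : ℂ)))
    (hprod : ∀ k, HasProd (fun N : ℕ => 𝓕 (fun u =>
          (normIndicator (transWindow A.toLinearMap Ω) u : ℂ))
          ((LinearMap.adjoint A.toLinearMap ^ N) k))
        (𝓕 (fun u => (f u : ℂ)) k))
    (hg : Continuous g) (hgc : HasCompactSupport g) (hg1 : ∫ u, g u = 1)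
    (hfix : refinementOperator A Ω g = g) : g = f := by
  have hK := isCompact_transWindow (A := A.toLinearMap) hΩ hne
  have hvol := volume_real_pos_of_interior_nonempty hK hcompat
  have hgi : Integrable (fun u => (g u : ℂ)) := (hg.integrable_of_hasCompactSupport hgc).ofReal
  have hstep : ∀ k, 𝓕 (fun u => (g u : ℂ)) k = 𝓕 (fun u =>
      (normIndicator (transWindow A.toLinearMap Ω) u : ℂ)) k *
      𝓕 (fun u => (g u : ℂ)) (LinearMap.adjoint A.toLinearMap k) :=
    fun k => by
      rw [← fourier_refinementOperator A hK hvol hg hgc, hfix]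
  have hiter : ∀ k (N : ℕ), 𝓕 (fun u => (g u : ℂ)) k = (∏ j ∈ Finset.range N, 𝓕 (fun u =>
      (normIndicator (transWindow A.toLinearMap Ω) u : ℂ))
      ((LinearMap.adjoint A.toLinearMap ^ j) k)) *
      𝓕 (fun u => (g u : ℂ))
        ((LinearMap.adjoint A.toLinearMap ^ N) k) := fun k N => by
    induction N with
    | zero => simp
    | succ N ih =>
      rw [Finset.prod_range_succ, mul_assoc, pow_succ', Module.End.mul_apply, ← hstep]
      exact ih
  have hlim : ∀ k, 𝓕 (fun u => (g u : ℂ)) k = 𝓕 (fun u => (f u : ℂ)) k := fun k => by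
    have h1 := (hprod k).tendsto_prod_nat.mul
      (((continuous_fourier_of_integrable hgi).tendsto 0).comp
        (tendsto_adjoint_pow A hΩ hne hcompat k))
    rw [fourier_zero_eq, hg1, Complex.ofReal_one, mul_one] at h1
    exact tendsto_nhds_unique (tendsto_const_nhds.congr (hiter k)) h1
  have := eq_of_fourier_eq (Complex.continuous_ofReal.comp hf)
    (hf.integrable_of_hasCompactSupport hfc).ofReal (Complex.continuous_ofReal.comp hg) hgi hF
    (funext hlim)
  exact funext fun x => Complex.ofReal_injective (congrFun this x)

end Refinement

/-! ### Counting lattice points by tiles -/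

section Tiling

variable {E : Type*} [NormedAddCommGroup E] [MeasurableSpace E] [BorelSpace E]

/-- A bounded measurable set whose translates by the lattice `L` tile the space. -/
structure IsBoundedTile (L : Submodule ℤ E) (μ : Measure E) (F : Set E) (R : ℝ) : Prop where
  radius_nonneg : 0 ≤ R
  measurableSet : MeasurableSet F
  measure_pos : 0 < μ.real F
  measure_ne_top : μ F ≠ ⊤
  norm_le : ∀ x ∈ F, ‖x‖ ≤ R
  exists_mem : ∀ x, ∃ l ∈ L, x - l ∈ F
  unique : ∀ x, ∀ l ∈ L, ∀ l' ∈ L, x - l ∈ F → x - l' ∈ F → l = l'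

theorem exists_isBoundedTile [NormedSpace ℝ E] [FiniteDimensional ℝ E]
    (L : Submodule ℤ E) [DiscreteTopology L] [IsZLattice ℝ L]
    (μ : Measure E) [μ.IsAddHaarMeasure] : ∃ F R, IsBoundedTile L μ F R := by
  have := ZLattice.module_finite ℝ L
  have := ZLattice.module_free ℝ L
  set b := (Module.Free.chooseBasis ℤ L).ofZLatticeBasis ℝ L
  have hspan : Submodule.span ℤ (Set.range b) = L :=
    (Module.Free.chooseBasis ℤ L).ofZLatticeBasis_span ℝ
  have hbdd := ZSpan.fundamentalDomain_isBounded b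
  obtain ⟨R, hR0, hR⟩ := hbdd.exists_pos_norm_le
  have hfin : μ (ZSpan.fundamentalDomain b) ≠ ⊤ := hbdd.measure_lt_top.ne
  refine ⟨ZSpan.fundamentalDomain b, R, hR0.le, ZSpan.fundamentalDomain_measurableSet b,
    ENNReal.toReal_pos (ZSpan.measure_fundamentalDomain_ne_zero b) hfin, hfin, hR,
    fun x => ?_, fun x l hl l' hl' h h' => ?_⟩
  · obtain ⟨v, hv, -⟩ := ZSpan.exist_unique_vadd_mem_fundamentalDomain b x
    have hvL : (v : E) ∈ L := hspan.le v.2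
    refine ⟨-(v : E), L.neg_mem hvL, ?_⟩
    rw [sub_neg_eq_add, add_comm]
    exact hv
  · obtain ⟨v, -, hv⟩ := ZSpan.exist_unique_vadd_mem_fundamentalDomain b x
    have key : ∀ y, ∀ hy : y ∈ L, x - y ∈ ZSpan.fundamentalDomain b →
        (⟨-y, hspan.symm ▸ L.neg_mem hy⟩ : Submodule.span ℤ (Set.range b)) = v :=
      fun y hy h => hv _ (by
        change -y + x ∈ _
        rwa [neg_add_eq_sub])
    have := (key l hl h).trans (key l' hl' h').symm
    exact neg_injective (Subtype.ext_iff.1 this)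

namespace IsBoundedTile

variable {L : Submodule ℤ E} {μ : Measure E} [μ.IsAddHaarMeasure] {F : Set E} {R : ℝ}

theorem measureReal_translate (h : IsBoundedTile L μ F R) (P : Finset E)
    (hP : ∀ l ∈ P, l ∈ L) :
    μ.real (⋃ l ∈ P, {x | x - l ∈ F}) = P.card * μ.real F := by
  have hmeas : ∀ l : E, MeasurableSet {x | x - l ∈ F} := fun l =>
    h.measurableSet.preimage (measurable_id.sub_const l)
  have hvol : ∀ l : E, μ {x | x - l ∈ F} = μ F := fun l => by
    have := measure_preimage_add_right μ (-l) F
    simp only [← sub_eq_add_neg] at this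
    exact this
  rw [measureReal_biUnion_finset ?_ (fun l _ => hmeas l) (fun l _ => (hvol l).symm ▸
    h.measure_ne_top)]
  · simp [Measure.real, hvol]
  · intro l hl l' hl' hne
    refine Set.disjoint_left.2 fun x hx hx' => hne ?_
    exact h.unique x l (hP l hl) l' (hP l' hl') hx hx'

/-- Packing: the tiles at `P` are disjoint and fit into `D`. -/
theorem card_mul_le (h : IsBoundedTile L μ F R) {P : Finset E} (hP : ∀ l ∈ P, l ∈ L) {D : Set E}
    (hD : μ D ≠ ⊤) (hsub : ∀ l ∈ P, ∀ x ∈ F, l + x ∈ D) : P.card * μ.real F ≤ μ.real D := by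
  rw [← h.measureReal_translate P hP]
  refine measureReal_mono (iUnion₂_subset fun l hl x hx => ?_) hD
  simpa using hsub l hl _ hx

/-- Covering: every point of `D` lies in some tile, and `P` contains all tiles that meet `D`. -/
theorem le_card_mul [ProperSpace E] (h : IsBoundedTile L μ F R) {P : Finset E}
    (hP : ∀ l ∈ P, l ∈ L) {D : Set E}
    (hsub : ∀ l ∈ L, ∀ x ∈ D, x - l ∈ F → l ∈ P) : μ.real D ≤ P.card * μ.real F := by
  rw [← h.measureReal_translate P hP]
  refine measureReal_mono (fun x hx => ?_) ?_
  · obtain ⟨l, hl, hxl⟩ := h.exists_mem x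
    exact mem_iUnion₂.2 ⟨l, hsub l hl x hx hxl, hxl⟩
  · have hbdd : Bornology.IsBounded (⋃ l ∈ P, {x | x - l ∈ F}) := by
      refine (Bornology.isBounded_biUnion_finset P).2 fun l _ => ?_
      refine (Metric.isBounded_closedBall (x := l) (r := R)).subset fun x hx => ?_
      simpa [dist_eq_norm] using h.norm_le _ hx
    exact hbdd.measure_lt_top.ne

end IsBoundedTile

end Tiling

theorem tendsto_shell_volume (m : ℕ) (r : ℝ) :
    Tendsto (fun s : ℝ => ((s + r) ^ m - (s - r) ^ m) / s ^ m) atTop (𝓝 0) := by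
  have h : Tendsto (fun s : ℝ => (1 + r / s) ^ m - (1 - r / s) ^ m) atTop (𝓝 0) := by
    have h0 : Tendsto (fun s : ℝ => r / s) atTop (𝓝 0) := tendsto_const_nhds.div_atTop tendsto_id
    simpa using (((tendsto_const_nhds (x := (1 : ℝ))).add h0).pow m).sub
      (((tendsto_const_nhds (x := (1 : ℝ))).sub h0).pow m)
  refine h.congr' ?_
  filter_upwards [eventually_gt_atTop 0] with s hs
  rw [sub_div, ← div_pow, ← div_pow, add_div, sub_div, div_self hs.ne']

namespace CutProjectScheme

variable {m n : ℕ} (S : CutProjectScheme m n)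

theorem finite_box (s ρ : ℝ) :
    {l : EuclideanSpace ℝ (Fin m) × EuclideanSpace ℝ (Fin n) |
      l ∈ S.lattice ∧ ‖l.1‖ ≤ s ∧ ‖l.2‖ ≤ ρ}.Finite := by
  have := S.discrete
  have hclosed : IsClosed (S.lattice : Set (EuclideanSpace ℝ (Fin m) × EuclideanSpace ℝ (Fin n))) :=
    @AddSubgroup.isClosed_of_discrete _ _ _ _ _ S.lattice.toAddSubgroup
      (inferInstanceAs (DiscreteTopology S.lattice))
  refine (Metric.finite_isBounded_inter_isClosed DiscreteTopology.isDiscrete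
    (Metric.isBounded_closedBall (x := (0 : EuclideanSpace ℝ (Fin m) × EuclideanSpace ℝ (Fin n)))
      (r := max s ρ)) hclosed).subset ?_
  rintro l ⟨hl, h1, h2⟩
  refine ⟨mem_closedBall_zero_iff.2 ?_, hl⟩
  exact max_le_max h1 h2

/-- The lattice points `l` with `‖l.1‖ ≤ s` and `‖l.2‖ ≤ ρ`. -/
noncomputable def box (s ρ : ℝ) :
    Finset (EuclideanSpace ℝ (Fin m) × EuclideanSpace ℝ (Fin n)) :=
  (S.finite_box s ρ).toFinset

theorem mem_box {s ρ : ℝ} {l : EuclideanSpace ℝ (Fin m) × EuclideanSpace ℝ (Fin n)} :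
    l ∈ S.box s ρ ↔ l ∈ S.lattice ∧ ‖l.1‖ ≤ s ∧ ‖l.2‖ ≤ ρ := by
  simp [box]

instance isAddHaarMeasure_volume_prod :
    (volume : Measure (EuclideanSpace ℝ (Fin m) × EuclideanSpace ℝ (Fin n))).IsAddHaarMeasure := by
  rw [Measure.volume_eq_prod]
  infer_instance

theorem exists_tile : ∃ F R, IsBoundedTile S.lattice volume F R := by
  have := S.discrete
  have := S.isZLattice
  exact exists_isBoundedTile S.lattice volume

theorem volume_real_closedBall_prod {s ρ : ℝ} (hs : 0 ≤ s) (hρ : 0 ≤ ρ) :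
    volume.real (Metric.closedBall (0 : EuclideanSpace ℝ (Fin m)) s ×ˢ
      Metric.closedBall (0 : EuclideanSpace ℝ (Fin n)) ρ) =
      s ^ m * volume.real (Metric.ball (0 : EuclideanSpace ℝ (Fin m)) 1) *
        (ρ ^ n * volume.real (Metric.ball (0 : EuclideanSpace ℝ (Fin n)) 1)) := by
  rw [Measure.volume_eq_prod, measureReal_prod_prod, Measure.addHaar_real_closedBall _ _ hs,
    Measure.addHaar_real_closedBall _ _ hρ, finrank_euclideanSpace_fin,
    finrank_euclideanSpace_fin]

theorem volume_closedBall_prod_ne_top (s ρ : ℝ) :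
    volume (Metric.closedBall (0 : EuclideanSpace ℝ (Fin m)) s ×ˢ
      Metric.closedBall (0 : EuclideanSpace ℝ (Fin n)) ρ) ≠ ⊤ :=
  (Metric.isBounded_closedBall.prod Metric.isBounded_closedBall).measure_lt_top.ne

/-- An upper bound for the number of lattice points in a box. -/
theorem exists_card_box_le {ρ : ℝ} (hρ : 0 ≤ ρ) :
    ∃ D, 0 ≤ D ∧ ∀ s ≥ 1, ((S.box s ρ).card : ℝ) ≤ D * s ^ m := by
  obtain ⟨F, R, h⟩ := S.exists_tile
  have hR := h.radius_nonneg
  set c := volume.real (Metric.ball (0 : EuclideanSpace ℝ (Fin m)) 1) *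
        ((ρ + R) ^ n * volume.real (Metric.ball (0 : EuclideanSpace ℝ (Fin n)) 1))
  have hc : 0 ≤ c := by positivity
  refine ⟨(1 + R) ^ m * c / volume.real F, by have := h.measure_pos; positivity, fun s hs => ?_⟩
  rw [div_mul_eq_mul_div, le_div_iff₀ h.measure_pos]
  refine (h.card_mul_le (fun l hl => (S.mem_box.1 hl).1)
    (volume_closedBall_prod_ne_top (s + R) (ρ + R)) fun l hl x hx => ?_).trans ?_
  · obtain ⟨-, h1, h2⟩ := S.mem_box.1 hl
    have hx' := h.norm_le x hx
    exact ⟨by simpa using norm_add_le_of_le h1 ((norm_fst_le x).trans hx'),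
      by simpa using norm_add_le_of_le h2 ((norm_snd_le x).trans hx')⟩
  · rw [volume_real_closedBall_prod (by linarith) (by linarith), mul_assoc]
    change _ * c ≤ _
    have : (s + R) ^ m ≤ ((1 + R) * s) ^ m := pow_le_pow_left₀ (by linarith) (by nlinarith) _
    rw [mul_pow] at this
    nlinarith

/-- The number of lattice points in a thin shell is negligible. -/
theorem tendsto_card_shell {ρ r : ℝ} (hρ : 0 ≤ ρ) (hr : 0 ≤ r) :
    Tendsto (fun s => (((S.box (s + r) ρ).filter fun l => s - r < ‖l.1‖).card : ℝ) / s ^ m)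
      atTop (𝓝 0) := by
  obtain ⟨F, R, h⟩ := S.exists_tile
  have hR := h.radius_nonneg
  set c := volume.real (Metric.ball (0 : EuclideanSpace ℝ (Fin m)) 1) *
        ((ρ + R) ^ n * volume.real (Metric.ball (0 : EuclideanSpace ℝ (Fin n)) 1))
  have hlim := (tendsto_shell_volume m (r + R)).const_mul (c / volume.real F)
  rw [mul_zero] at hlim
  refine tendsto_of_tendsto_of_tendsto_of_le_of_le' tendsto_const_nhds hlim ?_ ?_
  · filter_upwards [eventually_ge_atTop 0] with s hs
    positivity
  · filter_upwards [eventually_gt_atTop (r + R)] with s hs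
    have hs0 : 0 < s := by linarith
    rw [div_mul_div_comm, div_le_div_iff₀ (by positivity) (mul_pos h.measure_pos (by positivity))]
    rw [← mul_assoc]
    refine mul_le_mul_of_nonneg_right ?_ (by positivity)
    have hsub : Metric.closedBall (0 : EuclideanSpace ℝ (Fin m)) (s - (r + R)) ×ˢ
        Metric.closedBall (0 : EuclideanSpace ℝ (Fin n)) (ρ + R) ⊆
        Metric.closedBall (0 : EuclideanSpace ℝ (Fin m)) (s + (r + R)) ×ˢ
        Metric.closedBall (0 : EuclideanSpace ℝ (Fin n)) (ρ + R) :=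
      prod_mono (Metric.closedBall_subset_closedBall (by linarith)) le_rfl
    -- Tiles have radius at most `R`, so those based in the shell of half-width `r` lie in the shell
    -- of half-width `r + R`, of negligible volume.
    refine (h.card_mul_le (D := (Metric.closedBall (0 : EuclideanSpace ℝ (Fin m)) (s + (r + R)) ×ˢ
        Metric.closedBall (0 : EuclideanSpace ℝ (Fin n)) (ρ + R)) \
        (Metric.closedBall (0 : EuclideanSpace ℝ (Fin m)) (s - (r + R)) ×ˢ
        Metric.closedBall (0 : EuclideanSpace ℝ (Fin n)) (ρ + R)))
        (fun l hl => (S.mem_box.1 (Finset.mem_filter.1 hl).1).1)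
        (measure_ne_top_of_subset sdiff_subset (volume_closedBall_prod_ne_top _ _))
        fun l hl x hx => ?_).trans ?_
    · obtain ⟨hl, h3⟩ := Finset.mem_filter.1 hl
      obtain ⟨-, h1, h2⟩ := S.mem_box.1 hl
      have hx' := h.norm_le x hx
      have hx1 := (norm_fst_le x).trans hx'
      refine ⟨⟨?_, ?_⟩, fun hmem => ?_⟩
      · have := norm_add_le_of_le h1 hx1
        simpa [add_assoc] using this
      · simpa using norm_add_le_of_le h2 ((norm_snd_le x).trans hx')
      · have h4 : ‖l.1 + x.1‖ ≤ s - (r + R) := by simpa using hmem.1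
        have h5 := norm_sub_le_norm_add l.1 x.1
        linarith
    · rw [measureReal_sdiff hsub
        (Metric.isClosed_closedBall.measurableSet.prod Metric.isClosed_closedBall.measurableSet)
        (volume_closedBall_prod_ne_top _ _), volume_real_closedBall_prod (by linarith) (by linarith),
        volume_real_closedBall_prod (by linarith) (by linarith)]
      refine le_of_eq ?_
      simp only [c]
      ring

/-- A lower bound for the number of lattice points in a large box. -/
theorem exists_le_card_box :
    ∃ ρ c : ℝ, 0 ≤ ρ ∧ 0 < c ∧ ∀ᶠ s in atTop, c * s ^ m ≤ ((S.box s ρ).card : ℝ) := by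
  obtain ⟨F, R, h⟩ := S.exists_tile
  have hR := h.radius_nonneg
  have hb1 : 0 < volume.real (Metric.ball (0 : EuclideanSpace ℝ (Fin m)) 1) :=
    ENNReal.toReal_pos (Metric.measure_ball_pos _ _ one_pos).ne' measure_ball_lt_top.ne
  have hb2 : 0 < volume.real (Metric.ball (0 : EuclideanSpace ℝ (Fin n)) 1) :=
    ENNReal.toReal_pos (Metric.measure_ball_pos _ _ one_pos).ne' measure_ball_lt_top.ne
  set c := volume.real (Metric.ball (0 : EuclideanSpace ℝ (Fin m)) 1) *
    volume.real (Metric.ball (0 : EuclideanSpace ℝ (Fin n)) 1)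
  have hc : 0 < c := mul_pos hb1 hb2
  -- Tiles meeting the unit ball of internal space are based within `1 + R`; the factor `(1 / 2) ^
  -- m` comes from `s - R ≥ s / 2`.
  refine ⟨1 + R, (1 / 2) ^ m * c / volume.real F, by linarith,
    div_pos (by positivity) h.measure_pos, ?_⟩
  filter_upwards [eventually_ge_atTop (2 * R + 1)] with s hs
  rw [div_mul_eq_mul_div, div_le_iff₀ h.measure_pos]
  refine le_trans ?_ (h.le_card_mul (P := S.box s (1 + R)) (fun l hl => (S.mem_box.1 hl).1)
    (D := Metric.closedBall (0 : EuclideanSpace ℝ (Fin m)) (s - R) ×ˢ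
        Metric.closedBall (0 : EuclideanSpace ℝ (Fin n)) 1) fun l hl x hx hxl => ?_)
  · rw [volume_real_closedBall_prod (by linarith) zero_le_one, mul_assoc]
    rw [one_pow, one_mul]
    rw [mul_assoc ((s - R) ^ m)]
    change _ ≤ _ * c
    have : ((1 / 2) * s) ^ m ≤ (s - R) ^ m := pow_le_pow_left₀ (by linarith) (by linarith) _
    rw [mul_pow] at this
    nlinarith
  · have hxl' := h.norm_le _ hxl
    have h1 : ‖x.1‖ ≤ s - R := by simpa using hx.1
    have h2 : ‖x.2‖ ≤ 1 := by simpa using hx.2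
    have h3 : ‖x.1 - l.1‖ ≤ R := (norm_fst_le (x - l)).trans hxl'
    have h4 : ‖x.2 - l.2‖ ≤ R := (norm_snd_le (x - l)).trans hxl'
    have h5 := norm_le_norm_add_norm_sub' l.1 x.1
    have h6 := norm_le_norm_add_norm_sub' l.2 x.2
    rw [norm_sub_rev] at h5 h6
    exact S.mem_box.2 ⟨hl, by linarith, by linarith⟩

end CutProjectScheme

/-! ### Uniform distribution of the internal coordinates -/

namespace CutProjectScheme

variable {m n : ℕ} (S : CutProjectScheme m n)

/-- The sum of `h (l.2)` over all lattice points `l` with `‖l.1‖ ≤ s`. -/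
noncomputable def latticeSum (s : ℝ) (h : EuclideanSpace ℝ (Fin n) → ℝ) : ℝ :=
  ∑ᶠ l ∈ {l : EuclideanSpace ℝ (Fin m) × EuclideanSpace ℝ (Fin n) | l ∈ S.lattice ∧ ‖l.1‖ ≤ s},
    h l.2

variable {g h : EuclideanSpace ℝ (Fin n) → ℝ} {ρ s : ℝ}

theorem latticeSum_eq (hg : Function.support g ⊆ Metric.closedBall 0 ρ) (s : ℝ) :
    S.latticeSum s g = ∑ l ∈ S.box s ρ, g l.2 := by
  refine finsum_mem_eq_sum_of_inter_support_eq _ ?_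
  ext l
  simp only [mem_inter_iff, mem_ofPred_eq, Function.mem_support, SetLike.mem_coe, mem_box]
  refine ⟨fun hl => ⟨⟨hl.1.1, hl.1.2, ?_⟩, hl.2⟩, fun hl => ⟨⟨hl.1.1, hl.1.2.1⟩, hl.2⟩⟩
  simpa using hg hl.2

theorem abs_latticeSum_le (hg : Function.support g ⊆ Metric.closedBall 0 ρ) {G : ℝ}
    (hG : ∀ y, |g y| ≤ G) : |S.latticeSum s g| ≤ G * (S.box s ρ).card := by
  rw [S.latticeSum_eq hg]
  refine (Finset.abs_sum_le_sum_abs _ _).trans ((Finset.sum_le_card_nsmul _ _ G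
    fun l _ => hG _).trans_eq ?_)
  rw [nsmul_eq_mul, mul_comm]

theorem latticeSum_mono (hg : Function.support g ⊆ Metric.closedBall 0 ρ)
    (hh : Function.support h ⊆ Metric.closedBall 0 ρ) (hgh : ∀ y, g y ≤ h y) :
    S.latticeSum s g ≤ S.latticeSum s h := by
  rw [S.latticeSum_eq hg, S.latticeSum_eq hh]
  exact Finset.sum_le_sum fun l _ => hgh _

theorem latticeSum_sub (hg : Function.support g ⊆ Metric.closedBall 0 ρ)
    (hh : Function.support h ⊆ Metric.closedBall 0 ρ) :
    S.latticeSum s (fun y => g y - h y) = S.latticeSum s g - S.latticeSum s h := by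
  rw [S.latticeSum_eq hg, S.latticeSum_eq hh, S.latticeSum_eq
    ((Function.support_sub g h).trans (union_subset hg hh)), Finset.sum_sub_distrib]

theorem support_translate_subset (hg : Function.support g ⊆ Metric.closedBall 0 ρ)
    {t : EuclideanSpace ℝ (Fin n)} {r : ℝ} (ht : ‖t‖ ≤ r) :
    Function.support (fun y => g (y - t)) ⊆ Metric.closedBall 0 (ρ + r) := fun y hy => by
  have h1 : ‖y - t‖ ≤ ρ := by simpa using hg hy
  have h2 := norm_le_norm_add_norm_sub' y t
  rw [mem_closedBall_zero_iff]
  linarith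

open Classical in
/-- Translation by the internal part of a lattice point changes a lattice sum only in a shell. -/
theorem abs_latticeSum_translate_sub_le (hg : Function.support g ⊆ Metric.closedBall 0 ρ) {G : ℝ}
    (hG : ∀ y, |g y| ≤ G) {l' : EuclideanSpace ℝ (Fin m) × EuclideanSpace ℝ (Fin n)}
    (hl' : l' ∈ S.lattice) (s : ℝ) :
    |S.latticeSum s (fun y => g (y - l'.2)) - S.latticeSum s g| ≤
      G * ((S.box (s + ‖l'.1‖) ρ).filter fun l => s - ‖l'.1‖ < ‖l.1‖).card := by
  have hG0 : 0 ≤ G := (abs_nonneg _).trans (hG 0)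
  -- After the shift by `l'`, both sums run over this box, with cutoffs `‖l.1‖ ≤ s` and `‖l.1 +
  -- l'.1‖ ≤ s`. The cutoffs can differ only in the shell.
  set B := S.box (s + ‖l'.1‖) ρ
  have h1 : S.latticeSum s g = ∑ l ∈ B, if ‖l.1‖ ≤ s then g l.2 else 0 := by
    rw [← Finset.sum_filter]
    refine finsum_mem_eq_sum_of_inter_support_eq _ ?_
    ext l
    simp only [mem_inter_iff, mem_ofPred_eq, Function.mem_support, Finset.coe_filter, B, mem_box]
    refine ⟨fun hl => ⟨⟨⟨hl.1.1, ?_, ?_⟩, hl.1.2⟩, hl.2⟩, fun hl => ⟨⟨hl.1.1.1, hl.1.2⟩, hl.2⟩⟩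
    · linarith [hl.1.2, norm_nonneg l'.1]
    · simpa using hg hl.2
  have h2 : S.latticeSum s (fun y => g (y - l'.2)) =
      ∑ l ∈ B, if ‖l.1 + l'.1‖ ≤ s then g l.2 else 0 := by
    rw [← Finset.sum_filter]
    have hbij : S.latticeSum s (fun y => g (y - l'.2)) = ∑ᶠ l ∈ {l : EuclideanSpace ℝ (Fin m) ×
        EuclideanSpace ℝ (Fin n) | l ∈ S.lattice ∧ ‖l.1 + l'.1‖ ≤ s}, g l.2 := by
      refine finsum_mem_eq_of_bijOn (fun l => l - l') ⟨fun l hl => ?_, ?_, fun l hl => ?_⟩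
        fun l _ => rfl
      · exact ⟨S.lattice.sub_mem hl.1 hl', by simpa using hl.2⟩
      · exact fun _ _ _ _ h => sub_left_injective h
      · exact ⟨l + l', ⟨S.lattice.add_mem hl.1 hl', by simpa using hl.2⟩, by simp⟩
    rw [hbij]
    refine finsum_mem_eq_sum_of_inter_support_eq _ ?_
    ext l
    simp only [mem_inter_iff, mem_ofPred_eq, Function.mem_support, Finset.coe_filter, B, mem_box]
    refine ⟨fun hl => ⟨⟨⟨hl.1.1, ?_, ?_⟩, hl.1.2⟩, hl.2⟩, fun hl => ⟨⟨hl.1.1.1, hl.1.2⟩, hl.2⟩⟩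
    · linarith [hl.1.2, norm_sub_le_norm_add l.1 l'.1]
    · simpa using hg hl.2
  rw [h1, h2, ← Finset.sum_sub_distrib, mul_comm, ← nsmul_eq_mul, ← Finset.sum_const,
    Finset.sum_filter]
  refine (Finset.abs_sum_le_sum_abs _ _).trans (Finset.sum_le_sum fun l _ => ?_)
  by_cases h3 : s - ‖l'.1‖ < ‖l.1‖
  · rw [if_pos h3]
    split_ifs
    · simpa using hG0
    · simpa using hG _
    · simpa using hG _
    · simpa using hG0
  · rw [if_neg h3]
    have h4 : ‖l.1‖ ≤ s := by linarith [norm_nonneg l'.1]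
    have h5 : ‖l.1 + l'.1‖ ≤ s := (norm_add_le _ _).trans (by linarith)
    rw [if_pos h4, if_pos h5, sub_self, abs_zero]

theorem exists_bound_of_hasCompactSupport (hg : Continuous g) (hgc : HasCompactSupport g) :
    ∃ ρ G, 0 ≤ ρ ∧ 0 ≤ G ∧ Function.support g ⊆ Metric.closedBall 0 ρ ∧ ∀ y, |g y| ≤ G := by
  obtain ⟨ρ, hρ0, hρ⟩ := hgc.isCompact.isBounded.exists_pos_norm_le
  obtain ⟨G, hG⟩ := hgc.exists_bound_of_continuous hg
  exact ⟨ρ, G, hρ0.le, (norm_nonneg _).trans (hG 0),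
    fun y hy => by simpa using hρ y (subset_tsupport g hy), hG⟩

/-- Lattice sums are asymptotically invariant under translations of the internal space. -/
theorem tendsto_latticeSum_translate_sub (hg : Continuous g) (hgc : HasCompactSupport g)
    (t : EuclideanSpace ℝ (Fin n)) :
    Tendsto (fun s => (S.latticeSum s (fun y => g (y - t)) - S.latticeSum s g) / s ^ m) atTop
      (𝓝 0) := by
  obtain ⟨ρ, G, hρ, hG0, hsupp, hG⟩ := exists_bound_of_hasCompactSupport hg hgc
  obtain ⟨D, hD0, hD⟩ := S.exists_card_box_le (ρ := ρ + (‖t‖ + 1)) (by positivity)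
  rw [Metric.tendsto_nhds]
  intro ε hε
  obtain ⟨δ, hδ, hδg⟩ := Metric.uniformContinuous_iff.1
    (hgc.uniformContinuous_of_continuous hg) (ε / (2 * (D + 1))) (by positivity)
  -- Density replaces `t` by the internal part of a lattice point: uniform continuity controls the
  -- replacement, the shell estimate the lattice translation.
  obtain ⟨_, ⟨l', hl', rfl⟩, hl'δ⟩ := S.dense_snd.exists_dist_lt t (lt_min hδ one_pos)
  have hl't : ‖l'.2‖ ≤ ‖t‖ + 1 := by
    have := norm_le_norm_add_norm_sub' l'.2 t
    rw [← dist_eq_norm, dist_comm] at this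
    linarith [hl'δ.trans_le (min_le_right _ _)]
  have hshell := (S.tendsto_card_shell hρ (norm_nonneg l'.1)).const_mul G
  rw [mul_zero] at hshell
  filter_upwards [eventually_ge_atTop 1, hshell.eventually_lt_const (half_pos hε)] with s hs hs2
  have hsm : (0 : ℝ) < s ^ m := by positivity
  rw [dist_zero_right, norm_div, Real.norm_of_nonneg hsm.le, div_lt_iff₀ hsm, Real.norm_eq_abs]
  have e1 : |S.latticeSum s (fun y => g (y - t)) - S.latticeSum s (fun y => g (y - l'.2))| ≤
      ε / (2 * (D + 1)) * (D * s ^ m) := by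
    have s1 := support_translate_subset hsupp (t := t) (r := ‖t‖ + 1) (by linarith)
    have s2 := support_translate_subset hsupp hl't
    rw [← S.latticeSum_sub s1 s2]
    refine (S.abs_latticeSum_le ((Function.support_sub _ _).trans (union_subset s1 s2))
      (G := ε / (2 * (D + 1))) fun y => ?_).trans ?_
    · rw [← Real.dist_eq]
      refine (hδg ?_).le
      rw [dist_sub_left, dist_comm, dist_comm]
      exact hl'δ.trans_le (min_le_left _ _)
    · exact mul_le_mul_of_nonneg_left (hD s hs) (by positivity)
  have e2 := S.abs_latticeSum_translate_sub_le hsupp hG hl' s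
  have e3 : ε / (2 * (D + 1)) * (D * s ^ m) ≤ ε / 2 * s ^ m := by
    rw [← mul_assoc]
    refine mul_le_mul_of_nonneg_right ?_ hsm.le
    rw [div_mul_eq_mul_div, div_le_div_iff₀ (by positivity) two_pos]
    nlinarith
  have e4 : G * ((S.box (s + ‖l'.1‖) ρ).filter fun l => s - ‖l'.1‖ < ‖l.1‖).card <
      ε / 2 * s ^ m := by
    rw [← mul_div_assoc, div_lt_iff₀ hsm] at hs2
    convert! hs2
  have := abs_sub_le (S.latticeSum s (fun y => g (y - t))) (S.latticeSum s fun y => g (y - l'.2))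
    (S.latticeSum s g)
  linarith

/-- The sum of `h ⋆ g` is the `h`-weighted integral of the sums of translates of `g`, each
asymptotic to the sum of `g`. Dominated convergence applies because `h` has compact support. -/
theorem tendsto_latticeSum_convolution_sub (hg : Continuous g) (hgc : HasCompactSupport g)
    (hh : Continuous h) (hhc : HasCompactSupport h) :
    Tendsto (fun s => (S.latticeSum s (h ⋆[ContinuousLinearMap.mul ℝ ℝ, volume] g) -
      S.latticeSum s g * ∫ t, h t) / s ^ m) atTop (𝓝 0) := by
  obtain ⟨ρ, G, hρ, hG0, hsupp, hG⟩ := exists_bound_of_hasCompactSupport hg hgc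
  obtain ⟨r, H, hr, hH0, hhsupp, hH⟩ := exists_bound_of_hasCompactSupport hh hhc
  obtain ⟨D, hD0, hD⟩ := S.exists_card_box_le (ρ := ρ + r) (by positivity)
  have hhi : Integrable h := hh.integrable_of_hasCompactSupport hhc
  have hconv : Function.support (h ⋆[ContinuousLinearMap.mul ℝ ℝ, volume] g) ⊆
      Metric.closedBall 0 (ρ + r) := by
    refine (support_convolution_subset _).trans ?_
    rintro _ ⟨x, hx, y, hy, rfl⟩
    have h1 : ‖x‖ ≤ r := by simpa using hhsupp hx
    have h2 : ‖y‖ ≤ ρ := by simpa using hsupp hy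
    rw [mem_closedBall_zero_iff, add_comm ρ]
    exact norm_add_le_of_le h1 h2
  have hprod : ∀ y, Integrable fun t => h t * g (y - t) := fun y =>
    (hh.mul (hg.comp (continuous_const.sub continuous_id))).integrable_of_hasCompactSupport
      hhc.mul_right
  have hterm : ∀ s t, h t * S.latticeSum s (fun y => g (y - t)) =
      ∑ l ∈ S.box s (ρ + r), h t * g (l.2 - t) := fun s t => by
    by_cases ht : h t = 0
    · simp [ht]
    · have : ‖t‖ ≤ r := by simpa using hhsupp ht
      rw [S.latticeSum_eq (support_translate_subset hsupp this), Finset.mul_sum]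
  have hint : ∀ s, Integrable fun t => h t * S.latticeSum s (fun y => g (y - t)) := fun s => by
    simp_rw [hterm]
    exact integrable_finsetSum _ fun l _ => hprod _
  have hsum : ∀ s, S.latticeSum s (h ⋆[ContinuousLinearMap.mul ℝ ℝ, volume] g) =
      ∫ t, h t * S.latticeSum s (fun y => g (y - t)) := fun s => by
    rw [S.latticeSum_eq hconv]
    simp_rw [hterm, convolution_mul]
    rw [integral_finsetSum _ fun l _ => hprod _]
  have heq : ∀ s, (S.latticeSum s (h ⋆[ContinuousLinearMap.mul ℝ ℝ, volume] g) -
      S.latticeSum s g * ∫ t, h t) / s ^ m = ∫ t, h t *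
        ((S.latticeSum s (fun y => g (y - t)) - S.latticeSum s g) / s ^ m) := fun s => by
    rw [hsum, mul_comm, ← integral_mul_const, ← integral_sub (hint s) (hhi.mul_const _),
      ← integral_div]
    refine integral_congr_ae (Eventually.of_forall fun t => ?_)
    ring
  simp_rw [heq]
  have hzero : (0 : ℝ) = ∫ t : EuclideanSpace ℝ (Fin n), h t * 0 := by simp
  rw [hzero]
  refine tendsto_integral_filter_of_dominated_convergence (fun t => |h t| * (2 * (G * D)))
    ?_ ?_ (hhi.abs.mul_const _) ?_
  · refine Eventually.of_forall fun s => Integrable.aestronglyMeasurable ?_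
    refine (((hint s).sub (hhi.mul_const (S.latticeSum s g))).div_const (s ^ m)).congr
      (Eventually.of_forall fun t => ?_)
    simp only [Pi.sub_apply]
    ring
  · filter_upwards [eventually_ge_atTop 1] with s hs
    refine Eventually.of_forall fun t => ?_
    by_cases ht : h t = 0
    · simp [ht]
    have htr : ‖t‖ ≤ r := by simpa using hhsupp ht
    have hsm : (0 : ℝ) < s ^ m := by positivity
    rw [norm_mul, norm_div, Real.norm_of_nonneg hsm.le, Real.norm_eq_abs, Real.norm_eq_abs]
    refine mul_le_mul_of_nonneg_left ?_ (abs_nonneg _)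
    rw [div_le_iff₀ hsm]
    have b1 := S.abs_latticeSum_le (s := s) (support_translate_subset hsupp htr) fun y => hG (y - t)
    have b2 := S.abs_latticeSum_le (s := s) (hsupp.trans
      (Metric.closedBall_subset_closedBall (by linarith : ρ ≤ ρ + r))) hG
    have b3 := mul_le_mul_of_nonneg_left (hD s hs) hG0
    have := abs_sub (S.latticeSum s (fun y => g (y - t))) (S.latticeSum s g)
    linarith
  · exact Eventually.of_forall fun t =>
      (S.tendsto_latticeSum_translate_sub hg hgc t).const_mul (h t)

/-- Commutativity of convolution, with the previous lemma applied in both orders. -/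
theorem tendsto_latticeSum_mul_sub (hg : Continuous g) (hgc : HasCompactSupport g)
    (hh : Continuous h) (hhc : HasCompactSupport h) :
    Tendsto (fun s => (S.latticeSum s g * (∫ t, h t) - S.latticeSum s h * ∫ t, g t) / s ^ m)
      atTop (𝓝 0) := by
  have hcomm : (h ⋆[ContinuousLinearMap.mul ℝ ℝ, volume] g) =
      g ⋆[ContinuousLinearMap.mul ℝ ℝ, volume] h := by
    ext x
    rw [convolution_mul, convolution_mul_swap]
    simp only [mul_comm]
  have := (S.tendsto_latticeSum_convolution_sub hh hhc hg hgc).sub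
    (S.tendsto_latticeSum_convolution_sub hg hgc hh hhc)
  rw [hcomm, sub_zero] at this
  refine this.congr fun s => ?_
  ring

/-- Uniform distribution of cut and project sets, for continuous functions of compact support. -/
theorem exists_tendsto_latticeSum_div :
    ∃ a : ℝ → ℝ, (∀ᶠ s in atTop, 0 < a s) ∧
      ∀ g : EuclideanSpace ℝ (Fin n) → ℝ, Continuous g → HasCompactSupport g →
        Tendsto (fun s => S.latticeSum s g / a s) atTop (𝓝 (∫ y, g y)) := by
  obtain ⟨ρ, c, hρ, hc, hcard⟩ := S.exists_le_card_box
  -- A reference function that is at least 1 on the ball of radius `ρ`, so its lattice sums inherit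
  -- the lower bound of order `s ^ m` and can serve as the normalizer.
  set h : EuclideanSpace ℝ (Fin n) → ℝ := fun y => max 0 (ρ + 1 - ‖y‖)
  have hh : Continuous h := by fun_prop
  have hsupp : Function.support h ⊆ Metric.closedBall 0 (ρ + 1) := fun y hy => by
    rw [mem_closedBall_zero_iff]
    by_contra hy'
    exact hy (max_eq_left (by linarith))
  have hhc : HasCompactSupport h :=
    HasCompactSupport.of_support_subset_isCompact (isCompact_closedBall _ _) hsupp
  have hpos : 0 < ∫ y, h y := by
    refine hh.integral_pos_of_hasCompactSupport_nonneg_nonzero hhc (fun y => le_max_left _ _)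
      (x := 0) (ne_of_gt ?_)
    simp only [h, norm_zero, sub_zero]
    positivity
  have hlow : ∀ s, ((S.box s ρ).card : ℝ) ≤ S.latticeSum s h := fun s => by
    rw [S.latticeSum_eq hsupp]
    calc ((S.box s ρ).card : ℝ) = ∑ l ∈ S.box s ρ, (1 : ℝ) := by simp
      _ ≤ ∑ l ∈ S.box s ρ, h l.2 := Finset.sum_le_sum fun l hl => by
          have := (S.mem_box.1 hl).2.2
          exact le_max_of_le_right (by linarith)
      _ ≤ ∑ l ∈ S.box s (ρ + 1), h l.2 := by
          refine Finset.sum_le_sum_of_subset_of_nonneg (fun l hl => ?_) fun l _ _ => le_max_left _ _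
          have := S.mem_box.1 hl
          exact S.mem_box.2 ⟨this.1, this.2.1, by linarith [this.2.2]⟩
  have hev : ∀ᶠ s in atTop, 0 < s ^ m ∧ c * s ^ m ≤ S.latticeSum s h := by
    filter_upwards [hcard, eventually_gt_atTop 0] with s hs hs0
    exact ⟨by positivity, hs.trans (hlow s)⟩
  refine ⟨fun s => S.latticeSum s h / ∫ y, h y, ?_, fun g hg hgc => ?_⟩
  · filter_upwards [hev] with s hs
    exact div_pos (lt_of_lt_of_le (mul_pos hc hs.1) hs.2) hpos
  · rw [tendsto_iff_norm_sub_tendsto_zero]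
    have hlim := (S.tendsto_latticeSum_mul_sub hg hgc hh hhc).norm.mul_const c⁻¹
    rw [norm_zero, zero_mul] at hlim
    refine squeeze_zero' (Eventually.of_forall fun s => norm_nonneg _) ?_ hlim
    filter_upwards [hev] with s hs
    have hM : 0 < S.latticeSum s h := lt_of_lt_of_le (mul_pos hc hs.1) hs.2
    have : S.latticeSum s g / (S.latticeSum s h / ∫ y, h y) - ∫ y, g y =
        (S.latticeSum s g * (∫ t, h t) - S.latticeSum s h * ∫ t, g t) / S.latticeSum s h := by
      field_simp
    rw [this, norm_div, norm_div, Real.norm_of_nonneg hM.le, Real.norm_of_nonneg hs.1.le,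
      ← div_eq_mul_inv, div_div]
    gcongr
    · exact mul_pos hs.1 hc
    · rw [mul_comm]; exact hs.2

/-- A compact set with null boundary is a set of uniform distribution, weighted by a non-negative
continuous function. -/
theorem tendsto_latticeSum_indicator_div {a : ℝ → ℝ} (ha : ∀ᶠ s in atTop, 0 < a s)
    (hlim : ∀ g : EuclideanSpace ℝ (Fin n) → ℝ, Continuous g → HasCompactSupport g →
        Tendsto (fun s => S.latticeSum s g / a s) atTop (𝓝 (∫ y, g y)))
    {W : Set (EuclideanSpace ℝ (Fin n))} (hW : IsCompact W) (hfr : volume (frontier W) = 0)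
    (hg : Continuous g) (hgc : HasCompactSupport g) (hg0 : ∀ y, 0 ≤ g y) :
    Tendsto (fun s => S.latticeSum s (W.indicator g) / a s) atTop (𝓝 (∫ y in W, g y)) := by
  obtain ⟨ρ, G, hρ, hG0, hsupp, hG⟩ := exists_bound_of_hasCompactSupport hg hgc
  have hgi : Integrable g := hg.integrable_of_hasCompactSupport hgc
  have hWm : MeasurableSet W := hW.isClosed.measurableSet
  have hint : volume (interior W) = volume W := measure_interior_of_null_frontier hfr
  have hWi : Integrable (W.indicator g) := hgi.indicator hWm
  have hWsupp : Function.support (W.indicator g) ⊆ Metric.closedBall 0 ρ :=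
    (support_indicator.subset.trans inter_subset_right).trans hsupp
  have hφ : ∀ φ : C(EuclideanSpace ℝ (Fin n), ℝ),
      Continuous (fun y => φ y * g y) ∧ HasCompactSupport (fun y => φ y * g y) ∧
      Function.support (fun y => φ y * g y) ⊆ Metric.closedBall 0 ρ := fun φ =>
    ⟨φ.continuous.mul hg, hgc.mul_left,
      fun y hy => hsupp (right_ne_zero_of_mul hy)⟩
  rw [Metric.tendsto_nhds]
  intro ε hε
  set η : ℝ := ε / (2 * (G + 1))
  have hη : 0 < η := by positivity
  have hGη : G * η < ε := by
    simp only [η]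
    rw [mul_div_assoc', div_lt_iff₀ (by positivity)]
    nlinarith
  have hcompare : ∀ {u v : EuclideanSpace ℝ (Fin n) → ℝ} {D : Set (EuclideanSpace ℝ (Fin n))},
      Integrable u → Integrable v → MeasurableSet D → volume D < ENNReal.ofReal η →
      (∀ y, u y - v y ≤ D.indicator (fun _ => G) y) → ∫ y, u y ≤ (∫ y, v y) + G * η := by
    intro u v D hu hv hD hDη huv
    have hDfin : volume D ≠ ⊤ := hDη.ne_top
    have h1 : ∫ y, (u y - v y) ≤ ∫ y, D.indicator (fun _ => G) y :=
      integral_mono (hu.sub hv) ((integrableOn_const hDfin).integrable_indicator hD) huv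
    rw [integral_sub hu hv, integral_indicator hD, setIntegral_const, smul_eq_mul] at h1
    have h2 : volume.real D ≤ η := (ENNReal.toReal_lt_of_lt_ofReal hDη).le
    nlinarith
  -- Squeeze the indicator between continuous cutoffs `ψ` and `φ`, each of which changes the
  -- integral by at most `G * η < ε`.
  obtain ⟨U, hWU, hUo, -, hU⟩ := hWm.exists_isOpen_sdiff_lt (μ := volume)
    hW.measure_lt_top.ne (ENNReal.ofReal_pos.2 hη).ne'
  obtain ⟨φ, hφ1, -, hφU, hφ01⟩ := exists_continuousMap_one_of_isCompact_subset_isOpen hW hUo hWU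
  obtain ⟨K, hKW, hK, hKη⟩ := isOpen_interior.measurableSet.exists_isCompact_sdiff_lt (μ := volume)
    (A := interior W) (hint ▸ hW.measure_lt_top.ne) (ENNReal.ofReal_pos.2 hη).ne'
  obtain ⟨ψ, hψ1, -, hψW, hψ01⟩ :=
    exists_continuousMap_one_of_isCompact_subset_isOpen hK isOpen_interior hKW
  obtain ⟨hφc, hφcs, hφs⟩ := hφ φ
  obtain ⟨hψc, hψcs, hψs⟩ := hφ ψ
  have hout : ∀ y, W.indicator g y ≤ φ y * g y := fun y => by
    by_cases hy : y ∈ W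
    · simp [indicator_of_mem hy, hφ1 hy]
    · rw [indicator_of_notMem hy]
      exact mul_nonneg (hφ01 y).1 (hg0 y)
  have hin : ∀ y, ψ y * g y ≤ W.indicator g y := fun y => by
    by_cases hy : y ∈ W
    · rw [indicator_of_mem hy]
      exact mul_le_of_le_one_left (hg0 y) (hψ01 y).2
    · rw [indicator_of_notMem hy, image_eq_zero_of_notMem_tsupport fun h =>
        hy (interior_subset (hψW h)), zero_mul]
  have hgG : ∀ y, g y ≤ G := fun y => (le_abs_self _).trans (hG y)
  have hI1 : ∫ y, φ y * g y ≤ (∫ y, W.indicator g y) + G * η := by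
    refine hcompare (hφc.integrable_of_hasCompactSupport hφcs) hWi (hUo.measurableSet.diff hWm) hU
      fun y => ?_
    by_cases hy : y ∈ W
    · simp [hφ1 hy, hy]
    by_cases hyU : y ∈ U
    · rw [indicator_of_notMem hy, sub_zero, indicator_of_mem (show y ∈ U \ W from ⟨hyU, hy⟩)]
      exact (mul_le_of_le_one_left (hg0 y) (hφ01 y).2).trans (hgG y)
    · rw [indicator_of_notMem hy, image_eq_zero_of_notMem_tsupport fun h => hyU (hφU h)]
      simp [hyU]
  have hI2 : ∫ y, W.indicator g y ≤ (∫ y, ψ y * g y) + G * η := by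
    refine hcompare hWi (hψc.integrable_of_hasCompactSupport hψcs)
      (hWm.diff hK.isClosed.measurableSet) (lt_of_le_of_lt ?_ hKη) fun y => ?_
    -- Here the null boundary enters: a compact set exhausting the interior nearly exhausts `W`.
    · have hsub : W \ K ⊆ (interior W \ K) ∪ frontier W := fun y hy => by
        by_cases h : y ∈ interior W
        · exact Or.inl ⟨h, hy.2⟩
        · exact Or.inr ⟨subset_closure hy.1, h⟩
      exact (measure_mono hsub).trans ((measure_union_le _ _).trans_eq (by rw [hfr, add_zero]))
    · by_cases hy : y ∈ W
      · by_cases hyK : y ∈ K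
        · simp [indicator_of_mem hy, hψ1 hyK, hyK]
        · rw [indicator_of_mem hy, indicator_of_mem (show y ∈ W \ K from ⟨hy, hyK⟩)]
          have := mul_nonneg (hψ01 y).1 (hg0 y)
          linarith [hgG y]
      · rw [indicator_of_notMem hy, image_eq_zero_of_notMem_tsupport fun h =>
          hy (interior_subset (hψW h))]
        simp [hy]
  rw [integral_indicator hWm] at hI1 hI2
  have hgap : 0 < ε - G * η := by linarith
  filter_upwards [ha, (hlim _ hφc hφcs).eventually_lt_const (lt_add_of_pos_right _ hgap),
    (hlim _ hψc hψcs).eventually_const_lt (sub_lt_self _ hgap)] with s has h1 h2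
  have h3 := div_le_div_of_nonneg_right (S.latticeSum_mono (s := s) hWsupp hφs hout) has.le
  have h4 := div_le_div_of_nonneg_right (S.latticeSum_mono (s := s) hψs hWsupp hin) has.le
  rw [Real.dist_eq, abs_lt]
  constructor <;> linarith

end CutProjectScheme

/-! ### The star map, model sets and the induced linear map -/

namespace CutProjectScheme

variable {m n : ℕ} (S : CutProjectScheme m n)

theorem mk_star_mem {x : EuclideanSpace ℝ (Fin m)} (hx : x ∈ S.L) : (x, S.star x) ∈ S.lattice := by
  have h1 := Function.invFunOn_mem hx
  have h2 := Function.invFunOn_eq hx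
  have : (x, S.star x) = Function.invFunOn Prod.fst
      (S.lattice : Set (EuclideanSpace ℝ (Fin m) × EuclideanSpace ℝ (Fin n))) x :=
    Prod.ext h2.symm rfl
  rw [this]
  exact h1

theorem star_fst {l : EuclideanSpace ℝ (Fin m) × EuclideanSpace ℝ (Fin n)} (hl : l ∈ S.lattice) :
    S.star l.1 = l.2 := by
  have h : (l.1, S.star l.1) = l := S.injOn_fst (S.mk_star_mem ⟨l, hl, rfl⟩) hl rfl
  exact (Prod.ext_iff.1 h).2

theorem fst_mem_L {l : EuclideanSpace ℝ (Fin m) × EuclideanSpace ℝ (Fin n)} (hl : l ∈ S.lattice) :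
    l.1 ∈ S.L :=
  ⟨l, hl, rfl⟩

theorem sub_mem_L {x y : EuclideanSpace ℝ (Fin m)} (hx : x ∈ S.L) (hy : y ∈ S.L) : x - y ∈ S.L :=
  S.fst_mem_L (S.lattice.sub_mem (S.mk_star_mem hx) (S.mk_star_mem hy))

theorem star_sub {x y : EuclideanSpace ℝ (Fin m)} (hx : x ∈ S.L) (hy : y ∈ S.L) :
    S.star (x - y) = S.star x - S.star y :=
  S.star_fst (S.lattice.sub_mem (S.mk_star_mem hx) (S.mk_star_mem hy))

theorem add_mem_L {x y : EuclideanSpace ℝ (Fin m)} (hx : x ∈ S.L) (hy : y ∈ S.L) : x + y ∈ S.L :=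
  S.fst_mem_L (S.lattice.add_mem (S.mk_star_mem hx) (S.mk_star_mem hy))

theorem star_add {x y : EuclideanSpace ℝ (Fin m)} (hx : x ∈ S.L) (hy : y ∈ S.L) :
    S.star (x + y) = S.star x + S.star y :=
  S.star_fst (S.lattice.add_mem (S.mk_star_mem hx) (S.mk_star_mem hy))

theorem dense_star : Dense (S.star '' S.L) := by
  refine S.dense_snd.mono ?_
  rintro _ ⟨l, hl, rfl⟩
  exact ⟨l.1, S.fst_mem_L hl, S.star_fst hl⟩

theorem exists_star_mem {U : Set (EuclideanSpace ℝ (Fin n))} (hU : IsOpen U) (hne : U.Nonempty) :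
    ∃ x ∈ S.L, S.star x ∈ U := by
  obtain ⟨_, hxU, x, hx, rfl⟩ := S.dense_star.inter_open_nonempty U hU hne
  exact ⟨x, hx, hxU⟩

theorem finsum_truncate_modelSet (W : Set (EuclideanSpace ℝ (Fin n)))
    (h : EuclideanSpace ℝ (Fin n) → ℝ) (s : ℝ) :
    ∑ᶠ x ∈ truncate (S.modelSet W) s, h (S.star x) = S.latticeSum s (W.indicator h) := by
  have h1 : S.latticeSum s (W.indicator h) =
      ∑ᶠ x ∈ truncate S.L s, W.indicator h (S.star x) := by
    refine finsum_mem_eq_of_bijOn Prod.fst ⟨fun l hl => ⟨S.fst_mem_L hl.1, hl.2⟩,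
      S.injOn_fst.mono fun l hl => hl.1, ?_⟩ fun l hl => by rw [S.star_fst hl.1]
    rintro x ⟨hx, hxs⟩
    exact ⟨(x, S.star x), ⟨S.mk_star_mem hx, hxs⟩, rfl⟩
  rw [h1, finsum_mem_def, finsum_mem_def]
  refine finsum_congr fun x => ?_
  by_cases hx : x ∈ S.L ∧ ‖x‖ ≤ s
  · rw [indicator_of_mem (show x ∈ truncate S.L s from hx)]
    by_cases hW : S.star x ∈ W
    · rw [indicator_of_mem hW,
        indicator_of_mem (show x ∈ truncate (S.modelSet W) s from ⟨⟨hx.1, hW⟩, hx.2⟩)]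
    · rw [indicator_of_notMem hW, indicator_of_notMem fun hx' => hW hx'.1.2]
  · rw [indicator_of_notMem (show x ∉ truncate S.L s from hx),
      indicator_of_notMem fun hx' => hx ⟨hx'.1.1, hx'.2⟩]

theorem ncard_truncate_modelSet (W : Set (EuclideanSpace ℝ (Fin n))) (s : ℝ) :
    ((truncate (S.modelSet W) s).ncard : ℝ) = S.latticeSum s (W.indicator fun _ => 1) := by
  rw [← S.finsum_truncate_modelSet W (fun _ => 1) s]
  by_cases hfin : (truncate (S.modelSet W) s).Finite
  · rw [finsum_mem_eq_finite_toFinset_sum _ hfin, ncard_eq_toFinset_card _ hfin]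
    simp
  -- For an infinite set both sides take the default value 0.
  · rw [Infinite.ncard hfin, finsum_mem_eq_zero_of_infinite, Nat.cast_zero]
    rwa [Function.support_const one_ne_zero, inter_univ]

/-- The ratio of a weighted count to the number of points of a model set. -/
theorem tendsto_latticeSum_div_ncard {W : Set (EuclideanSpace ℝ (Fin n))} (hW : IsCompact W)
    (hfr : volume (frontier W) = 0) (hpos : 0 < volume.real W)
    {g : EuclideanSpace ℝ (Fin n) → ℝ} (hg : Continuous g) (hgc : HasCompactSupport g)
    (hg0 : ∀ y, 0 ≤ g y) :
    Tendsto (fun s => S.latticeSum s (W.indicator g) / ((truncate (S.modelSet W) s).ncard : ℝ))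
      atTop (𝓝 ((∫ y in W, g y) / volume.real W)) := by
  obtain ⟨a, ha, hlim⟩ := S.exists_tendsto_latticeSum_div
  -- A compactly supported cutoff equal to 1 on `W` lets the weighted count yield the cardinality
  -- too; the normalizer `a` cancels in the quotient.
  obtain ⟨φ, hφ1, hφc, -, hφ01⟩ :=
    exists_continuousMap_one_of_isCompact_subset_isOpen hW isOpen_univ (subset_univ W)
  have h1 := S.tendsto_latticeSum_indicator_div ha hlim hW hfr hg hgc hg0
  have h2 := S.tendsto_latticeSum_indicator_div ha hlim hW hfr φ.continuous hφc
    fun y => (hφ01 y).1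
  have h3 : W.indicator φ = W.indicator fun _ => (1 : ℝ) := indicator_congr hφ1
  rw [h3, setIntegral_congr_fun hW.isClosed.measurableSet hφ1] at h2
  simp only [Pi.one_apply, setIntegral_const, smul_eq_mul, mul_one] at h2
  refine (h1.div h2 hpos.ne').congr' ?_
  filter_upwards [ha] with s hs
  rw [ncard_truncate_modelSet, Pi.div_apply, div_div_div_cancel_right₀ hs.ne']

theorem pullback_of_mem {Ω : Set (EuclideanSpace ℝ (Fin n))} {g : EuclideanSpace ℝ (Fin n) → ℝ}
    (hg : Function.support g ⊆ Ω) {x : EuclideanSpace ℝ (Fin m)} (hx : x ∈ S.L) :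
    S.pullback Ω g x = volume.real Ω * g (S.star x) := by
  by_cases h : S.star x ∈ Ω
  · rw [pullback, indicator_of_mem (show x ∈ S.modelSet Ω from ⟨hx, h⟩), smul_eq_mul]
  · rw [pullback, indicator_of_notMem fun hx' => h hx'.2,
      Function.notMem_support.1 fun h' => h (hg h'), mul_zero]

theorem tendsto_normalization {Ω : Set (EuclideanSpace ℝ (Fin n))} (hΩ : IsCompact Ω)
    (hfr : volume (frontier Ω) = 0) (hpos : 0 < volume.real Ω)
    {g : EuclideanSpace ℝ (Fin n) → ℝ} (hg : Continuous g) (hgs : tsupport g ⊆ Ω)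
    (hg0 : ∀ y, 0 ≤ g y) :
    Tendsto (fun s : ℝ => (∑ᶠ x ∈ truncate (S.modelSet Ω) s, S.pullback Ω g x) /
      ((truncate (S.modelSet Ω) s).ncard : ℝ)) atTop (𝓝 (∫ y, g y)) := by
  have hgc : HasCompactSupport g := hΩ.of_isClosed_subset (isClosed_tsupport g) hgs
  have hsupp : Function.support g ⊆ Ω := (subset_tsupport g).trans hgs
  have h := S.tendsto_latticeSum_div_ncard hΩ hfr hpos
    (g := fun y => volume.real Ω * g y) (continuous_const.mul hg) hgc.mul_left fun y => mul_nonneg measureReal_nonneg (hg0 y)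
  rw [integral_const_mul, mul_div_cancel_left₀ _ hpos.ne',
    setIntegral_eq_integral_of_forall_compl_eq_zero
      fun y hy => Function.notMem_support.1 fun h => hy (hsupp h)] at h
  refine h.congr fun s => ?_
  rw [← finsum_truncate_modelSet]
  refine congrArg (· / _) (finsum_mem_congr rfl fun x hx => ?_)
  exact (S.pullback_of_mem hsupp hx.1.1).symm

section StarMap

variable {Q : EuclideanSpace ℝ (Fin m) ≃ₗ[ℝ] EuclideanSpace ℝ (Fin m)}

/-- The range is a closed subspace containing the dense set `L*`. -/
theorem surjective_of_isStarMap (hQL : Q '' S.L = S.L)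
    {A : EuclideanSpace ℝ (Fin n) →ₗ[ℝ] EuclideanSpace ℝ (Fin n)} (hA : S.IsStarMap Q A) :
    Function.Surjective A := by
  have hclosed : IsClosed (A.range : Set (EuclideanSpace ℝ (Fin n))) :=
    A.range.closed_of_finiteDimensional
  have hsub : S.star '' S.L ⊆ (A.range : Set (EuclideanSpace ℝ (Fin n))) := by
    rintro _ ⟨x, hx, rfl⟩
    rw [← hQL] at hx
    obtain ⟨y, hy, rfl⟩ := hx
    exact ⟨S.star y, (hA y hy).symm⟩
  rw [← LinearMap.range_eq_top, ← SetLike.coe_set_eq, ← hclosed.closure_eq]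
  exact (S.dense_star.mono hsub).closure_eq

theorem symm_mem_L (hQL : Q '' S.L = S.L) {x : EuclideanSpace ℝ (Fin m)} (hx : x ∈ S.L) :
    Q.symm x ∈ S.L := by
  rw [← hQL] at hx
  obtain ⟨y, hy, rfl⟩ := hx
  simpa using hy

/-- A self-similarity only gives `A x* + v* ∈ Ω` for points `x*` of `L*`; those in the interior are
dense in `Ω = closure (interior Ω)`, and the condition is closed. -/
theorem translations_eq {Ω : Set (EuclideanSpace ℝ (Fin n))} (hΩ : IsWindow Ω)
    (hne : Ω.Nonempty) (hQL : Q '' S.L = S.L)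
    {A : EuclideanSpace ℝ (Fin n) →ₗ[ℝ] EuclideanSpace ℝ (Fin n)} (hA : S.IsStarMap Q A) :
    S.translations Ω Q = S.modelSet (transWindow A Ω) := by
  have hQmem : ∀ x ∈ S.L, Q x ∈ S.L := fun x hx => hQL ▸ mem_image_of_mem Q hx
  have hint : (interior Ω).Nonempty := by
    rw [← closure_nonempty_iff, ← hΩ.eq_closure_interior]
    exact hne
  ext v
  constructor
  · intro hv
    -- A single point of the model set and its image show that `v ∈ L`.
    obtain ⟨x₀, hx₀, hx₀Ω⟩ := S.exists_star_mem isOpen_interior hint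
    have hvL : v ∈ S.L := by
      have h1 : Q x₀ + v ∈ S.L := (hv ⟨hx₀, interior_subset hx₀Ω⟩).1
      simpa using S.sub_mem_L h1 (hQmem _ hx₀)
    refine ⟨hvL, ?_⟩
    have hclosed : IsClosed {y | A y + S.star v ∈ Ω} :=
      hΩ.isCompact.isClosed.preimage
        ((LinearMap.continuous_of_finiteDimensional A).add continuous_const)
    have hsub : interior Ω ∩ S.star '' S.L ⊆ {y | A y + S.star v ∈ Ω} := by
      rintro _ ⟨hy, x, hx, rfl⟩
      have h1 := (hv ⟨hx, interior_subset hy⟩).2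
      rwa [S.star_add (hQmem x hx) hvL, hA x hx] at h1
    have hcl := closure_minimal hsub hclosed
    intro y hy
    rw [hΩ.eq_closure_interior] at hy
    exact hcl (closure_minimal (S.dense_star.open_subset_closure_inter isOpen_interior)
      isClosed_closure hy)
  · rintro ⟨hvL, hv⟩ x ⟨hx, hxΩ⟩
    refine ⟨S.add_mem_L (hQmem x hx) hvL, ?_⟩
    rw [S.star_add (hQmem x hx) hvL, hA x hx]
    exact hv _ hxΩ

/-- The map `Q × A` carries the lattice onto itself, so it preserves the covolume, which it
multiplies by the absolute value of its determinant. -/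
theorem abs_det_mul_abs_det_eq_one (hQL : Q '' S.L = S.L)
    {A : EuclideanSpace ℝ (Fin n) ≃ₗ[ℝ] EuclideanSpace ℝ (Fin n)}
    (hA : S.IsStarMap Q A.toLinearMap) :
    |LinearMap.det Q.toLinearMap| * |LinearMap.det A.toLinearMap| = 1 := by
  have := S.discrete
  have := S.isZLattice
  set e := (Q.prodCongr A).toContinuousLinearEquiv
  have hcomap : ZLattice.comap ℝ S.lattice e.toLinearMap = S.lattice := by
    ext l
    change (Q l.1, A l.2) ∈ S.lattice ↔ l ∈ S.lattice
    constructor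
    · intro h
      have h1 : l.1 ∈ S.L := by simpa using S.symm_mem_L hQL (S.fst_mem_L h)
      have h2 : A (S.star l.1) = A l.2 := (hA _ h1).symm.trans (S.star_fst h)
      have h3 := S.mk_star_mem h1
      rwa [A.injective h2] at h3
    · intro h
      have h1 : Q l.1 ∈ S.L := hQL ▸ mem_image_of_mem Q (S.fst_mem_L h)
      have h2 := S.mk_star_mem h1
      rwa [hA _ (S.fst_mem_L h), S.star_fst h] at h2
  set ν : Measure (EuclideanSpace ℝ (Fin m) × EuclideanSpace ℝ (Fin n)) :=
    (volume : Measure (EuclideanSpace ℝ (Fin m) × EuclideanSpace ℝ (Fin n))).map e.symm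
  have hνhaar : ν.IsAddHaarMeasure := e.symm.isAddHaarMeasure_map volume
  have hpres : MeasurePreserving e ν volume :=
    (e.symm.toHomeomorph.toMeasurableEquiv.measurable.measurePreserving volume).symm
      e.symm.toHomeomorph.toMeasurableEquiv
  have hcov := ZLattice.covolume_comap S.lattice volume ν hpres
  have heq : ∀ L' : Submodule ℤ (EuclideanSpace ℝ (Fin m) × EuclideanSpace ℝ (Fin n)),
      L' = S.lattice → ZLattice.covolume L' ν = ZLattice.covolume S.lattice ν := by
    rintro _ rfl; rfl
  rw [heq _ hcomap] at hcov
  have hν : ν = ENNReal.ofReal |(LinearMap.det e.symm.toLinearEquiv.toLinearMap)⁻¹| • volume :=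
    Measure.map_linearMap_addHaar_eq_smul_addHaar volume
      (f := e.symm.toLinearEquiv.toLinearMap) e.symm.toLinearEquiv.isUnit_det'.ne_zero
  rw [ZLattice.covolume_eq_measure_fundamentalDomain _ _
    (ZLattice.isAddFundamentalDomain (Module.Free.chooseBasis ℤ S.lattice) ν), hν,
    measureReal_ennreal_smul_apply, ← ZLattice.covolume_eq_measure_fundamentalDomain _ _
    (ZLattice.isAddFundamentalDomain (Module.Free.chooseBasis ℤ S.lattice) volume),
    ENNReal.toReal_ofReal (abs_nonneg _)] at hcov
  have hone := mul_eq_right₀ (ZLattice.covolume_ne_zero S.lattice volume) |>.1 hcov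
  have hdet : LinearMap.det (Q.prodCongr A).symm.toLinearMap =
      (LinearMap.det (Q.prodCongr A).toLinearMap)⁻¹ := by
    refine eq_inv_of_mul_eq_one_left ?_
    rw [← LinearMap.det_comp, LinearEquiv.comp_coe, LinearEquiv.self_trans_symm,
      LinearEquiv.refl_toLinearMap, LinearMap.det_id]
  have h2 : |LinearMap.det (Q.prodCongr A).toLinearMap| = 1 := by
    rw [← inv_inv (LinearMap.det (Q.prodCongr A).toLinearMap), ← hdet]
    exact hone
  rwa [LinearEquiv.coe_prodCongr, LinearMap.det_prodMap, abs_mul] at h2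

end StarMap

end CutProjectScheme

/-! ### The averaging operator in internal space -/

namespace CutProjectScheme

variable {m n : ℕ} (S : CutProjectScheme m n)
  {Q : EuclideanSpace ℝ (Fin m) ≃ₗ[ℝ] EuclideanSpace ℝ (Fin m)}
  {A : EuclideanSpace ℝ (Fin n) ≃ₗ[ℝ] EuclideanSpace ℝ (Fin n)}
  {Ω : Set (EuclideanSpace ℝ (Fin n))} {g : EuclideanSpace ℝ (Fin n) → ℝ}

/-- Written as a mean over `Ω_Q`, the form in which uniform distribution delivers the limit. -/
theorem refinementOperator_apply
    (hK : IsCompact (transWindow A.toLinearMap Ω)) (y : EuclideanSpace ℝ (Fin n)) :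
    refinementOperator A Ω g y = |LinearMap.det A.toLinearMap|⁻¹ *
      ((∫ u in transWindow A.toLinearMap Ω, g (A.symm (y - u))) /
        volume.real (transWindow A.toLinearMap Ω)) := by
  rw [refinementOperator, convolution_mul, div_eq_inv_mul, ← integral_const_mul,
    ← integral_const_mul, ← integral_indicator hK.isClosed.measurableSet]
  refine integral_congr_ae (Eventually.of_forall fun u => ?_)
  by_cases hu : u ∈ transWindow A.toLinearMap Ω
  · simp only [normIndicator, indicator_of_mem hu]
    ring
  · simp only [normIndicator, indicator_of_notMem hu, zero_mul]

/-- On functions `p_g`, the averaging operator is the refinement operator. -/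
theorem tendsto_partialAverage (hΩ : IsWindow Ω) (hne : Ω.Nonempty) (hQL : Q '' S.L = S.L)
    (hA : S.IsStarMap Q A.toLinearMap)
    (hcompat : (interior (transWindow A.toLinearMap Ω)).Nonempty)
    (hΩQ : volume (frontier (transWindow A.toLinearMap Ω)) = 0)
    (hg : Continuous g) (hgs : tsupport g ⊆ Ω) (hg0 : ∀ y, 0 ≤ g y)
    {x : EuclideanSpace ℝ (Fin m)} (hx : x ∈ S.L) :
    Tendsto (fun s : ℝ => S.partialAverage Ω Q (S.pullback Ω g) s x) atTop
      (𝓝 (volume.real Ω * refinementOperator A Ω g (S.star x))) := by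
  have hgc : HasCompactSupport g := hΩ.isCompact.of_isClosed_subset (isClosed_tsupport g) hgs
  have hK := isCompact_transWindow (A := A.toLinearMap) hΩ.isCompact hne
  have hpos := volume_real_pos_of_interior_nonempty hK hcompat
  set e : EuclideanSpace ℝ (Fin n) ≃ₜ EuclideanSpace ℝ (Fin n) :=
    (Homeomorph.subLeft (S.star x)).trans A.symm.toContinuousLinearEquiv.toHomeomorph
  have hcont : Continuous fun u => g (A.symm (S.star x - u)) := hg.comp e.continuous
  have hcs : HasCompactSupport fun u => g (A.symm (S.star x - u)) := hgc.comp_homeomorph e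
  have h := (S.tendsto_latticeSum_div_ncard hK hΩQ hpos
    (g := fun u => volume.real Ω * g (A.symm (S.star x - u))) (continuous_const.mul hcont)
    hcs.mul_left fun y => mul_nonneg measureReal_nonneg (hg0 _)).const_mul
    |LinearMap.det Q.toLinearMap|
  have hdet := eq_inv_of_mul_eq_one_left (S.abs_det_mul_abs_det_eq_one hQL hA)
  have hval : volume.real Ω * refinementOperator A Ω g (S.star x) =
      |LinearMap.det Q.toLinearMap| * ((∫ u in transWindow A.toLinearMap Ω,
        volume.real Ω * g (A.symm (S.star x - u))) /
        volume.real (transWindow A.toLinearMap Ω)) := by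
    rw [refinementOperator_apply hK, hdet, integral_const_mul]
    ring
  rw [hval]
  refine h.congr fun s => ?_
  rw [partialAverage, S.translations_eq hΩ hne hQL hA, ← finsum_truncate_modelSet,
    mul_div_assoc', mul_div_right_comm]
  refine congrArg _ (finsum_mem_congr rfl fun v hv => ?_)
  have hmem := S.symm_mem_L hQL (S.sub_mem_L hx hv.1.1)
  rw [S.pullback_of_mem ((subset_tsupport g).trans hgs) hmem]
  -- Under the star map, `t_v⁻¹ x` becomes `A⁻¹ (x* - v*)`.
  have : A (S.star (Q.symm (x - v))) = S.star x - S.star v := by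
    rw [← S.star_sub hx hv.1.1, ← LinearEquiv.coe_coe A, ← hA _ hmem, Q.apply_symm_apply]
  rw [← this, A.symm_apply_apply]

end CutProjectScheme

/-! ### The main theorem -/

theorem proposition2 {m n : ℕ} (S : CutProjectScheme m n)
    (Ω : Set (EuclideanSpace ℝ (Fin n))) (hΩ : IsWindow Ω) (hne : Ω.Nonempty)
    (Q : EuclideanSpace ℝ (Fin m) ≃ₗ[ℝ] EuclideanSpace ℝ (Fin m))
    (hQ : IsLinearSimilarity Q) (hQL : Q '' S.L = S.L)
    (A : EuclideanSpace ℝ (Fin n) →ₗ[ℝ] EuclideanSpace ℝ (Fin n)) (hA : S.IsStarMap Q A)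
    (hcompat : (interior (transWindow A Ω)).Nonempty)
    (hΩQ : volume (frontier (transWindow A Ω)) = 0) :
    ∃ f : EuclideanSpace ℝ (Fin n) → ℝ,
      -- `f` is a smooth probability density supported in the window
      (ContDiff ℝ ∞ f ∧ tsupport f ⊆ Ω ∧ (∀ u, 0 ≤ f u) ∧ ∫ u, f u = 1) ∧
      -- `f` is the infinite convolution of the normalized indicators of `A ^ N Ω_Q`
      TendstoUniformly
        (partialConvolution fun N => normIndicator (⇑(A ^ N) '' transWindow A Ω)) f atTop ∧
      -- the Fourier transform of `f` is the infinite product of the `X̂_{Ω_Q}((Aᵗ) ^ N k)`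
      (∀ k, HasProd
        (fun N : ℕ => 𝓕 (fun u => (normIndicator (transWindow A Ω) u : ℂ))
          ((LinearMap.adjoint A ^ N) k)) (𝓕 (fun u => (f u : ℂ)) k)) ∧
      -- and this property determines `f` in `𝒞(Ω)`
      (∀ g ∈ windowFunctions Ω,
        (∀ k, HasProd
          (fun N : ℕ => 𝓕 (fun u => (normIndicator (transWindow A Ω) u : ℂ))
            ((LinearMap.adjoint A ^ N) k)) (𝓕 g k)) →
        g = fun u => (f u : ℂ)) ∧
      -- `p_f` is an invariant density in `𝒞(Λ)`, and it is the only one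
      S.IsInvariantDensity Ω Q (S.pullback Ω f) ∧
      (fun x => ((S.pullback Ω f x : ℝ) : ℂ)) ∈ S.modelFunctions Ω ∧
      ∀ p : EuclideanSpace ℝ (Fin m) → ℝ, S.IsInvariantDensity Ω Q p →
        (fun x => (p x : ℂ)) ∈ S.modelFunctions Ω → p = S.pullback Ω f := by
  have hsurj := S.surjective_of_isStarMap hQL hA
  obtain ⟨A, rfl⟩ : ∃ A' : EuclideanSpace ℝ (Fin n) ≃ₗ[ℝ] EuclideanSpace ℝ (Fin n),
      A'.toLinearMap = A :=
    ⟨LinearEquiv.ofBijective A ⟨LinearMap.injective_iff_surjective.2 hsurj, hsurj⟩, rfl⟩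
  have hΩc := hΩ.isCompact
  have hint : (interior Ω).Nonempty := by
    rw [← closure_nonempty_iff, ← hΩ.eq_closure_interior]
    exact hne
  have hvol := volume_real_pos_of_interior_nonempty hΩc hint
  have hK := isCompact_transWindow (A := A.toLinearMap) hΩc hne
  have hKvol := volume_real_pos_of_interior_nonempty hK hcompat
  obtain ⟨f, ⟨hsmooth, hfs, hf0, hf1⟩, hunif, hprod, hFi, hfix⟩ :=
    exists_refinement_density A hΩc hne hcompat
  have hfc : Continuous f := hsmooth.continuous
  have hcs : ∀ {V : Type} [NormedAddCommGroup V] {g : EuclideanSpace ℝ (Fin n) → V},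
      tsupport g ⊆ Ω → HasCompactSupport g :=
    fun hg => hΩc.of_isClosed_subset (isClosed_tsupport _) hg
  have hfsupp : Function.support f ⊆ Ω := (subset_tsupport f).trans hfs
  refine ⟨f, ⟨hsmooth, hfs, hf0, hf1⟩, hunif, hprod, fun g hg hgprod => ?_,
    ⟨fun x hx => indicator_of_notMem hx _, fun x hx => ?_, fun x hx => ?_, ?_⟩, ?_,
    fun p hp hpm => ?_⟩
  · exact eq_of_fourier_eq (Complex.continuous_ofReal.comp hfc)
      (hfc.integrable_of_hasCompactSupport (hcs hfs)).ofReal hg.1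
      (hg.1.integrable_of_hasCompactSupport (hcs hg.2)) hFi
      (funext fun k => (hgprod k).unique (hprod k))
  · rw [S.pullback_of_mem hfsupp hx.1]
    exact mul_nonneg measureReal_nonneg (hf0 _)
  · have := S.tendsto_partialAverage hΩ hne hQL hA hcompat hΩQ hfc hfs hf0 hx
    rwa [hfix, ← S.pullback_of_mem hfsupp hx] at this
  · have := S.tendsto_normalization hΩc hΩ.volume_frontier hvol hfc hfs hf0
    rwa [hf1] at this
  · refine ⟨fun u => (f u : ℂ), ⟨Complex.continuous_ofReal.comp hfc,
      (tsupport_comp_subset Complex.ofReal_zero f).trans hfs⟩, funext fun x => ?_⟩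
    by_cases hx : x ∈ S.modelSet Ω
    · simp [CutProjectScheme.pullback, indicator_of_mem hx]
    · simp [CutProjectScheme.pullback, indicator_of_notMem hx]
  · obtain ⟨gC, ⟨hgC, hgCs⟩, hgp⟩ := hpm
    -- Since `p` is real, the real part of its complex representative already represents it.
    set g : EuclideanSpace ℝ (Fin n) → ℝ := fun u => (gC u).re
    have hg : Continuous g := Complex.continuous_re.comp hgC
    have hgs : tsupport g ⊆ Ω := (tsupport_comp_subset Complex.zero_re gC).trans hgCs
    have hgsupp : Function.support g ⊆ Ω := (subset_tsupport g).trans hgs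
    have hpg : p = S.pullback Ω g := funext fun x => by
      have h := congrArg Complex.re (congrFun hgp x)
      rw [Complex.ofReal_re] at h
      rw [← h]
      by_cases hx : x ∈ S.modelSet Ω
      · simp [CutProjectScheme.pullback, indicator_of_mem hx, g]
      · simp [CutProjectScheme.pullback, indicator_of_notMem hx]
    -- A negative value would persist on an open set, which contains `x*` for some `x ∈ L`; there
    -- `p` would be negative.
    have hg0 : ∀ u, 0 ≤ g u := fun u => by
      by_contra! hu
      obtain ⟨x, hx, hxg⟩ := S.exists_star_mem (isOpen_lt hg continuous_const) ⟨u, hu⟩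
      have hxΛ : x ∈ S.modelSet Ω := ⟨hx, hgsupp (ne_of_lt hxg)⟩
      have h := hp.nonneg x hxΛ
      rw [hpg, S.pullback_of_mem hgsupp hx] at h
      exact absurd (nonneg_of_mul_nonneg_right h hvol) (not_le.2 hxg)
    have hg1 : ∫ u, g u = 1 := by
      have h := hp.normalized
      rw [hpg] at h
      exact tendsto_nhds_unique
        (S.tendsto_normalization hΩc hΩ.volume_frontier hvol hg hgs hg0) h
    -- Invariance gives the equation on the dense set `L*`; continuity of both sides extends it.
    have hgfix : refinementOperator A Ω g = g := by
      refine Continuous.ext_on S.dense_star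
        (continuous_refinementOperator A hK hKvol hg (hcs hgs)) hg ?_
      rintro _ ⟨x, hx, rfl⟩
      have h := hp.average_eq x hx
      rw [hpg, S.pullback_of_mem hgsupp hx] at h
      exact mul_left_cancel₀ hvol.ne' (tendsto_nhds_unique
        (S.tendsto_partialAverage hΩ hne hQL hA hcompat hΩQ hg hgs hg0 hx) h)
    rw [hpg, eq_of_refinementOperator_eq A hΩc hne hcompat hfc (hcs hfs) hFi hprod hg (hcs hgs) hg1
      hgfix]
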